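/- For $f\in\mathbb R[x]$ put \[ \mathcal D_{\Xi}[f]=4x(x-1)^2f''+2(x-1)(7x-3)f'+(6x-5)f,\qquad \mathcal D_{\Lambda}[f]=4x(x-1)^2f''+6(x-1)(3x-1)f'+4(3x-2)f . \] Define the auxiliary families by $\widetilde\Xi_1=\tfrac14$, $\widetilde\Lambda_1=\tfrac17$ and, for $n\ge1$, \[ \widetilde\Xi_{n+1}=-\frac{1}{8n(2n+1)}\,\mathcal D_{\Xi}[\widetilde\Xi_n],\qquad \widetilde\Lambda_{n+1}=-\frac{2^{2n+1}-1}{(2^{2n+3}-1)(2n+1)(2n+2)}\,\mathcal D_{\Lambda}[\widetilde\Lambda_n]. \] Let $c,d\in\mathbb R$ with $c\neq0$, let $(A_n)_{n\ge1}$, $(B_n)_{n\ge1}$ be sequences of nonzero real numbers, and define $P_1^\Xi=P_1^\Lambda=cx-d$, $P_{n+1}^\Xi=A_n\,\mathcal D_\Xi[P_n^\Xi]$, $P_{n+1}^\Lambda=B_n\,\mathcal D_\Lambda[P_n^\Lambda]$ for $n\ge1$. Then for every $n\ge1$ the polynomials $\widetilde\Xi_n,\widetilde\Lambda_n$ have degree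 $n-1$, the polynomials $P_n^\Xi,P_n^\Lambda$ have degree $n$, and all zeros of these polynomials are real. For a nonconstant real-rooted polynomial $p$ let $\nu_p=\frac1{\deg p}\sum_{\xi}\delta_\xi$ be its empirical zero measure on $\mathbb R$, the sum running over the zeros $\xi$ of $p$ counted with multiplicity. Let $\mu$ be the measure on $\mathbb R$ with Lebesgue density \[ \rho(x)=\frac{2}{\sqrt x\,(1-x)\left(\log^2\!\left(\frac{1-\sqrt x}{1+\sqrt x}\right)+\pi^2\right)}\quad(0<x<1),\qquad \rho(x)=0\quad(x\notin(0,1)). \] Then $\mu$ is a probability measure with $\mu((0,1))=1$, and, as $n\to\infty$, each of the four sequences $\nu_{\widetilde\Xi_n}$, $\nu_{\widetilde\Lambda_n}$, $\nu_{P_n^\Xi}$, $\nu_{P_n^\Lambda}$ converges weakly to $\mu$ on $\mathbb R$. -/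

import Mathlib

open Polynomial MeasureTheory Filter Topology

noncomputable section

/-- The operator `4x(x-1)² f'' + 2(x-1)(7x-3) f' + (6x-5) f`. -/
def opXi (f : ℝ[X]) : ℝ[X] :=
  4 * X * (X - 1) ^ 2 * derivative (derivative f)
    + 2 * (X - 1) * (7 * X - 3) * derivative f + (6 * X - 5) * f

/-- The operator `4x(x-1)² f'' + 6(x-1)(3x-1) f' + 4(3x-2) f`. -/
def opLambda (f : ℝ[X]) : ℝ[X] :=
  4 * X * (X - 1) ^ 2 * derivative (derivative f)
    + 6 * (X - 1) * (3 * X - 1) * derivative f + 4 * (3 * X - 2) * f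

/-- The sequence `(p_n)_{n ≥ 1}` with `p_1 = p` and `p_{n+1} = w_n • D p_n` for `n ≥ 1`.
The index `0` is not used and carries the value `0`. -/
def iterSeq (D : ℝ[X] → ℝ[X]) (w : ℕ → ℝ) (p : ℝ[X]) : ℕ → ℝ[X]
  | 0 => 0
  | 1 => p
  | n + 2 => C (w (n + 1)) * D (iterSeq D w p (n + 1))

/-- The normalization constants of the first auxiliary family. -/
def coeffXi (n : ℕ) : ℝ := -1 / (8 * n * (2 * n + 1))

/-- The normalization constants of the second auxiliary family. -/
def coeffLambda (n : ℕ) : ℝ :=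
  -((2 : ℝ) ^ (2 * n + 1) - 1) / (((2 : ℝ) ^ (2 * n + 3) - 1) * (2 * n + 1) * (2 * n + 2))

/-- The first auxiliary family, indexed by `n ≥ 1`. -/
def auxXi : ℕ → ℝ[X] := iterSeq opXi coeffXi (C (1 / 4))

/-- The second auxiliary family, indexed by `n ≥ 1`. -/
def auxLambda : ℕ → ℝ[X] := iterSeq opLambda coeffLambda (C (1 / 7))

/-- The polynomials `P_n` generated by the first operator from `c x - d` with scalars `A`. -/
def seqXi (A : ℕ → ℝ) (c d : ℝ) : ℕ → ℝ[X] := iterSeq opXi A (C c * X - C d)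

/-- The polynomials `P_n` generated by the second operator from `c x - d` with scalars `B`. -/
def seqLambda (B : ℕ → ℝ) (c d : ℝ) : ℕ → ℝ[X] := iterSeq opLambda B (C c * X - C d)

/-- The unit point mass at `x`, as a finite measure. -/
def pointMass (x : ℝ) : FiniteMeasure ℝ := ⟨Measure.dirac x, inferInstance⟩

/-- The empirical zero measure `(1 / deg p) ∑ δ_x`, the sum running over the real zeros of `p`
with multiplicity. It is a probability measure when `p` is nonconstant with only real zeros. -/
def zeroMeasure (p : ℝ[X]) : FiniteMeasure ℝ :=
  (p.natDegree : NNReal)⁻¹ • (p.roots.map pointMass).sum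

/-- The limiting density, supported on `(0, 1)`. -/
def limitDensity (x : ℝ) : ℝ :=
  open Classical in
  if 0 < x ∧ x < 1 then
    2 / (√x * (1 - x) * (Real.log ((1 - √x) / (1 + √x)) ^ 2 + Real.pi ^ 2))
  else 0

/-- The limiting zero distribution. -/
def limitMeasure : Measure ℝ := volume.withDensity fun x => ENNReal.ofReal (limitDensity x)

end

/-! Put `x = tanh² u` and `w = sinh / cosh ^ (m + 1)`. Then `(w · f(tanh²))'' = w · (tanhOp m
f)(tanh²)`, with `m = 1` for `opXi` and `m = 2` for `opLambda`. Iterating the operator is thus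
repeated double differentiation in `u`.

Real zeros: `w · f(tanh²)` vanishes at `0` and at infinity, and its derivative vanishes at infinity,
so two uses of Rolle's theorem on `[0, ∞)` gain one zero. The `n`-th iterate of a polynomial of
degree at most `1` has degree at most `n + 1` and at least `n` zeros in `(0, 1)`; the possible
remaining root must be real (`splits_tanhOp_iterate`).

Limit: for `u > 0` and `m = 1, 2`, `w` is `-2` times the imaginary part of a sum of inverse powers
over the poles `i(π/2 + 2πn)`. Differentiating `2n` times only raises the exponent to `K = m + 1 +
2n` (`tanhWeight_mul_eval_iterate`). For large `K` the pole `iπ/2` dominates. With `u = (π/2) tan φ`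
its term has modulus `(π / (2 cos φ)) ^ (-K)` and argument `-Kφ`, so the iterate is, up to nonzero
factors, close to `-sin(Kφ)`. Its zeros are asymptotically equidistributed in `φ ∈ (0, π/2)`, and
`μ` is the image of the uniform law under `tanhSqTan`.

A linear starting polynomial yields a combination of two consecutive iterates of `1`, in which the
lower one is smaller by a factor of order `n⁻²`. Only lower bounds for root counts are needed: all
measures have mass one, so no mass can be left over elsewhere
(`tendsto_probabilityMeasure_of_le_Ioo`). -/

/-! ### The operators in the variable `tanh² u` -/

noncomputable section TanhOperator

/-- The polynomial `h` with `(sinh / cosh ^ (m + 1) * f (tanh²))' = h (tanh²) / cosh ^ m`. -/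
def tanhFlux (m : ℕ) (f : ℝ[X]) : ℝ[X] :=
  (1 - (m + 1 : ℝ[X]) * X) * f + 2 * X * (1 - X) * derivative f

/-- The operator corresponding to the second derivative with respect to `u` after the substitution
`x = tanh² u` and multiplication by `sinh / cosh ^ (m + 1)`. -/
def tanhOp (m : ℕ) (f : ℝ[X]) : ℝ[X] :=
  -(m : ℝ[X]) * tanhFlux m f + 2 * (1 - X) * derivative (tanhFlux m f)

lemma opXi_eq_tanhOp : opXi = tanhOp 1 := by
  funext f
  simp only [opXi, tanhOp, tanhFlux, derivative_add, derivative_mul, derivative_sub, derivative_one,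
    derivative_X, Nat.cast_one, derivative_ofNat]
  ring

lemma opLambda_eq_tanhOp : opLambda = tanhOp 2 := by
  funext f
  simp only [opLambda, tanhOp, tanhFlux, derivative_add, derivative_mul, derivative_sub,
    derivative_one, derivative_X, Nat.cast_ofNat, derivative_ofNat]
  ring

lemma tanhOp_add (m : ℕ) (f g : ℝ[X]) : tanhOp m (f + g) = tanhOp m f + tanhOp m g := by
  simp only [tanhOp, tanhFlux, derivative_add, mul_add]
  ring

lemma tanhOp_C_mul (m : ℕ) (r : ℝ) (f : ℝ[X]) : tanhOp m (C r * f) = C r * tanhOp m f := by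
  simp only [tanhOp, tanhFlux, derivative_add, derivative_C_mul,
    show ∀ p : ℝ[X], p * (C r * f) = C r * (p * f) from fun p => by ring,
    show ∀ p q : ℝ[X], p * (C r * q) = C r * (p * q) from fun p q => by ring]
  ring

lemma tanhOp_one (m : ℕ) :
    tanhOp m 1 = C ((m + 1) * (m + 2) : ℝ) * X - C (3 * m + 2 : ℝ) := by
  simp only [tanhOp, tanhFlux, derivative_add, derivative_mul, derivative_sub, derivative_one,
    derivative_X, derivative_natCast, C_mul, C_add, C_1, C_ofNat, map_natCast, derivative_zero]
  ring

/-- The nesting `X * (X * …)` lets `coeff_X_mul` peel off one factor at a time. -/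
lemma tanhOp_expand (m : ℕ) (f : ℝ[X]) :
    tanhOp m f = C 4 * (X * (X * (X * derivative (derivative f))))
      - C 8 * (X * (X * derivative (derivative f))) + C 4 * (X * derivative (derivative f))
      + C (4 * m + 10 : ℝ) * (X * (X * derivative f)) - C (4 * m + 16 : ℝ) * (X * derivative f)
      + C 6 * derivative f + C ((m + 1) * (m + 2) : ℝ) * (X * f) - C (3 * m + 2 : ℝ) * f := by
  simp only [tanhOp, tanhFlux, derivative_add, derivative_mul, derivative_sub, derivative_one,
    derivative_X, derivative_natCast, C_mul, C_add, C_1, C_ofNat, map_natCast, derivative_ofNat]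
  ring

lemma coeff_tanhOp_succ (m k : ℕ) (f : ℝ[X]) :
    (tanhOp m f).coeff (k + 1) = (2 * k + m + 1) * (2 * k + m + 2) * f.coeff k
      - (k + 1) * (8 * k + 4 * m + 16) * f.coeff (k + 1) - (3 * m + 2) * f.coeff (k + 1)
      + (k + 2) * (4 * k + 10) * f.coeff (k + 2) := by
  rw [tanhOp_expand]
  simp only [coeff_add, coeff_sub, coeff_C_mul]
  rcases k with _ | _ | k <;>
    simp [coeff_X_mul, coeff_derivative, mul_coeff_zero] <;> ring

/-- In degree `k` the top coefficient is multiplied by `(2k + m + 1)(2k + m + 2)`, which never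
vanishes. -/
lemma natDegree_tanhOp (m : ℕ) {f : ℝ[X]} (hf : f ≠ 0) :
    (tanhOp m f).natDegree = f.natDegree + 1 := by
  apply le_antisymm
  · rw [natDegree_le_iff_coeff_eq_zero]
    intro N hN
    obtain ⟨k, rfl⟩ : ∃ k, N = k + 1 := ⟨N - 1, by omega⟩
    rw [coeff_tanhOp_succ, coeff_eq_zero_of_natDegree_lt (by omega : f.natDegree < k),
      coeff_eq_zero_of_natDegree_lt (by omega : f.natDegree < k + 1),
      coeff_eq_zero_of_natDegree_lt (by omega : f.natDegree < k + 2)]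
    ring
  · apply le_natDegree_of_ne_zero
    rw [coeff_tanhOp_succ, coeff_eq_zero_of_natDegree_lt (by omega : f.natDegree < f.natDegree + 1),
      coeff_eq_zero_of_natDegree_lt (by omega : f.natDegree < f.natDegree + 2)]
    have h1 : f.coeff f.natDegree ≠ 0 := by simpa using hf
    have h2 : ((2 * f.natDegree + m + 1) * (2 * f.natDegree + m + 2) : ℝ) ≠ 0 := by positivity
    simpa using mul_ne_zero h2 h1

lemma tanhOp_iterate_ne_zero (m n : ℕ) {f : ℝ[X]} (hf : f ≠ 0) :
    (tanhOp m)^[n] f ≠ 0 ∧ ((tanhOp m)^[n] f).natDegree = f.natDegree + n := by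
  induction n with
  | zero => exact ⟨hf, rfl⟩
  | succ n ih =>
    rw [Function.iterate_succ_apply']
    have h := natDegree_tanhOp m ih.1
    refine ⟨fun h0 => ?_, by rw [h, ih.2]; ring⟩
    rw [h0, natDegree_zero] at h
    omega

lemma tanhOp_iterate_C_mul_add (m n : ℕ) (r s : ℝ) (f g : ℝ[X]) :
    (tanhOp m)^[n] (C r * f + C s * g) = C r * (tanhOp m)^[n] f + C s * (tanhOp m)^[n] g := by
  induction n with
  | zero => rfl
  | succ n ih => simp only [Function.iterate_succ_apply', ih, tanhOp_add, tanhOp_C_mul]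

lemma iterSeq_tanhOp (m : ℕ) (w : ℕ → ℝ) (hw : ∀ n, 1 ≤ n → w n ≠ 0) (p : ℝ[X]) (n : ℕ) :
    ∃ K : ℝ, K ≠ 0 ∧ iterSeq (tanhOp m) w p (n + 1) = C K * (tanhOp m)^[n] p := by
  induction n with
  | zero => exact ⟨1, one_ne_zero, by simp [iterSeq]⟩
  | succ n ih =>
    obtain ⟨K, hK, h⟩ := ih
    refine ⟨w (n + 1) * K, mul_ne_zero (hw _ (by omega)) hK, ?_⟩
    rw [iterSeq, h, tanhOp_C_mul, Function.iterate_succ_apply', C_mul, mul_assoc]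

/-- The iterates of a linear polynomial are combinations of iterates of the constant `1`. -/
lemma tanhOp_iterate_linear (m n : ℕ) (c d : ℝ) :
    (tanhOp m)^[n] (C c * X - C d) =
      C (c / ((m + 1) * (m + 2))) * (tanhOp m)^[n + 1] 1
        + C (c * (3 * m + 2) / ((m + 1) * (m + 2)) - d) * (tanhOp m)^[n] 1 := by
  rw [Function.iterate_succ_apply, ← tanhOp_iterate_C_mul_add, tanhOp_one]
  congr 1
  have h : ((m + 1) * (m + 2) : ℝ) ≠ 0 := by positivity
  rw [mul_sub, ← mul_assoc, ← C_mul, ← C_mul, C_sub, div_mul_cancel₀ _ h]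
  rw [div_mul_eq_mul_div]
  ring

end TanhOperator

/-! ### Derivatives in the variable `u` -/

noncomputable section Derivatives

open Real

lemma hasDerivAt_tanh_sq (u : ℝ) :
    HasDerivAt (fun u => tanh u ^ 2) (2 * tanh u * (1 - tanh u ^ 2)) u := by
  have h := ((hasDerivAt_sinh u).div (hasDerivAt_cosh u) (cosh_pos u).ne').pow 2
  have e : (fun u => tanh u ^ 2) = (sinh / cosh) ^ 2 := by
    funext v
    simp [tanh_eq_sinh_div_cosh]
  rw [e]
  refine h.congr_deriv ?_
  rw [tanh_eq_sinh_div_cosh]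
  have := (cosh_pos u).ne'
  simp only [Pi.div_apply, Nat.cast_ofNat, Nat.add_one_sub_one, pow_one]
  field_simp

lemma one_sub_tanh_sq (u : ℝ) : 1 - tanh u ^ 2 = 1 / cosh u ^ 2 := by
  rw [tanh_eq_sinh_div_cosh]
  have := (cosh_pos u).ne'
  field_simp
  rw [cosh_sq]
  ring

lemma hasDerivAt_inv_cosh_pow (m : ℕ) (u : ℝ) :
    HasDerivAt (fun u => 1 / cosh u ^ m) (-(m * tanh u / cosh u ^ m)) u := by
  have hc := (cosh_pos u).ne'
  have h := ((hasDerivAt_cosh u).pow m).inv (pow_ne_zero m hc)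
  have e : (fun u => 1 / cosh u ^ m) = (cosh ^ m)⁻¹ := by
    funext v
    simp
  rw [e]
  refine h.congr_deriv ?_
  rw [tanh_eq_sinh_div_cosh]
  rcases m with _ | m
  · simp
  · simp
    field_simp
    ring

lemma hasDerivAt_tanhWeight (m : ℕ) (u : ℝ) :
    HasDerivAt (fun u => sinh u / cosh u ^ (m + 1))
      ((1 - (m + 1) * tanh u ^ 2) / cosh u ^ m) u := by
  have hc := (cosh_pos u).ne'
  have h := (hasDerivAt_sinh u).mul (hasDerivAt_inv_cosh_pow (m + 1) u)
  have e : (fun u => sinh u / cosh u ^ (m + 1)) = sinh * fun u => 1 / cosh u ^ (m + 1) := by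
    funext v
    simp [div_eq_mul_inv]
  rw [e]
  refine h.congr_deriv ?_
  rw [tanh_eq_sinh_div_cosh]
  push_cast
  field_simp
  ring

lemma hasDerivAt_tanhWeight_mul (m : ℕ) (f : ℝ[X]) (u : ℝ) :
    HasDerivAt (fun u => sinh u / cosh u ^ (m + 1) * f.eval (tanh u ^ 2))
      (1 / cosh u ^ m * (tanhFlux m f).eval (tanh u ^ 2)) u := by
  have hc := (cosh_pos u).ne'
  have h := (hasDerivAt_tanhWeight m u).mul
    ((f.hasDerivAt (tanh u ^ 2)).comp u (hasDerivAt_tanh_sq u))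
  refine h.congr_deriv ?_
  simp only [tanhFlux, eval_add, eval_mul, eval_sub, eval_one, eval_X, eval_natCast, eval_ofNat,
    Function.comp_apply]
  rw [show sinh u = tanh u * cosh u by rw [tanh_eq_sinh_div_cosh]; field_simp]
  field_simp
  ring

lemma hasDerivAt_flux (m : ℕ) (f : ℝ[X]) (u : ℝ) :
    HasDerivAt (fun u => 1 / cosh u ^ m * (tanhFlux m f).eval (tanh u ^ 2))
      (sinh u / cosh u ^ (m + 1) * (tanhOp m f).eval (tanh u ^ 2)) u := by
  have hc := (cosh_pos u).ne'
  have h := (hasDerivAt_inv_cosh_pow m u).mul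
    (((tanhFlux m f).hasDerivAt (tanh u ^ 2)).comp u (hasDerivAt_tanh_sq u))
  refine h.congr_deriv ?_
  simp only [tanhOp, eval_add, eval_mul, eval_sub, eval_one, eval_X, eval_natCast, eval_ofNat,
    Function.comp_apply, eval_neg]
  rw [show sinh u = tanh u * cosh u by rw [tanh_eq_sinh_div_cosh]; field_simp]
  field_simp
  ring

lemma tendsto_cosh_atTop : Tendsto cosh atTop atTop := by
  have h : Tendsto (fun u : ℝ => exp u / 2) atTop atTop :=
    tendsto_exp_atTop.atTop_div_const two_pos
  refine tendsto_atTop_mono (fun u => ?_) h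
  rw [cosh_eq]
  have := exp_pos (-u)
  linarith

lemma tendsto_tanh_sq_atTop : Tendsto (fun u => tanh u ^ 2) atTop (𝓝 1) := by
  have h : Tendsto (fun u => 1 - 1 / cosh u ^ 2) atTop (𝓝 (1 - 0)) := by
    refine tendsto_const_nhds.sub ?_
    simp only [one_div]
    exact ((tendsto_pow_atTop two_ne_zero).comp tendsto_cosh_atTop).inv_tendsto_atTop
  rw [sub_zero] at h
  refine h.congr fun u => ?_
  rw [← one_sub_tanh_sq]
  ring

lemma tendsto_eval_tanh_sq (f : ℝ[X]) :
    Tendsto (fun u => f.eval (tanh u ^ 2)) atTop (𝓝 (f.eval 1)) :=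
  (f.continuous.tendsto 1).comp tendsto_tanh_sq_atTop

lemma tendsto_inv_cosh_pow {m : ℕ} (hm : m ≠ 0) :
    Tendsto (fun u => 1 / cosh u ^ m) atTop (𝓝 0) := by
  simp only [one_div]
  exact ((tendsto_pow_atTop hm).comp tendsto_cosh_atTop).inv_tendsto_atTop

lemma tendsto_flux_atTop {m : ℕ} (hm : m ≠ 0) (f : ℝ[X]) :
    Tendsto (fun u => 1 / cosh u ^ m * f.eval (tanh u ^ 2)) atTop (𝓝 0) := by
  simpa using (tendsto_inv_cosh_pow hm).mul (tendsto_eval_tanh_sq f)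

lemma tendsto_tanhWeight_mul_atTop {m : ℕ} (hm : m ≠ 0) (f : ℝ[X]) :
    Tendsto (fun u => sinh u / cosh u ^ (m + 1) * f.eval (tanh u ^ 2)) atTop (𝓝 0) := by
  rw [tendsto_zero_iff_abs_tendsto_zero]
  refine squeeze_zero (fun u => abs_nonneg _) (fun u => ?_)
    ((tendsto_zero_iff_abs_tendsto_zero _).1 (tendsto_flux_atTop hm f))
  simp only [Function.comp_apply, abs_mul]
  refine mul_le_mul_of_nonneg_right ?_ (abs_nonneg _)
  rw [show sinh u / cosh u ^ (m + 1) = tanh u * (1 / cosh u ^ m) by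
    rw [tanh_eq_sinh_div_cosh]; field_simp; ring, abs_mul]
  exact mul_le_of_le_one_left (abs_nonneg _) (abs_tanh_lt_one u).le

end Derivatives

/-! ### Counting zeros by Rolle's theorem -/

section Rolle

/-- By Darboux a derivative without zeros has constant sign; `F` would then be strictly monotone and
stay beyond `F (a + 1) ≠ 0`, away from its limit `0`. -/
lemma exists_hasDerivAt_eq_zero_Ioi {F F' : ℝ → ℝ} {a : ℝ} (hF : ∀ x, HasDerivAt F (F' x) x)
    (ha : F a = 0) (hlim : Tendsto F atTop (𝓝 0)) : ∃ c, a < c ∧ F' c = 0 := by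
  by_contra! hne
  have hcont : ContinuousOn F (Set.Ici a) := fun x _ => (hF x).continuousAt.continuousWithinAt
  rcases hasDerivWithinAt_forall_lt_or_forall_gt_of_forall_ne (convex_Ioi a)
    (fun x _ => (hF x).hasDerivWithinAt) (fun x hx => hne x hx) with h | h
  · have hanti : StrictAntiOn F (Set.Ici a) :=
      strictAntiOn_of_deriv_neg (convex_Ici a) hcont fun x hx => by
        rw [interior_Ici] at hx
        rw [(hF x).deriv]
        exact h x hx
    have h1 : F (a + 1) < 0 := ha ▸ hanti Set.self_mem_Ici (by simp) (by linarith)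
    refine h1.not_ge (le_of_tendsto hlim ?_)
    filter_upwards [eventually_ge_atTop (a + 1)] with x hx
    exact hanti.antitoneOn (by simp) (by simp; linarith) hx
  · have hmono : StrictMonoOn F (Set.Ici a) :=
      strictMonoOn_of_deriv_pos (convex_Ici a) hcont fun x hx => by
        rw [interior_Ici] at hx
        rw [(hF x).deriv]
        exact h x hx
    have h1 : 0 < F (a + 1) := ha ▸ hmono Set.self_mem_Ici (by simp) (by linarith)
    refine h1.not_ge (ge_of_tendsto hlim ?_)
    filter_upwards [eventually_ge_atTop (a + 1)] with x hx
    exact hmono.monotoneOn (by simp) (by simp; linarith) hx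

/-- A function vanishing at infinity and on a finite set `s ⊆ [0, ∞)` has a derivative with at
least `#s` zeros in `(0, ∞)`. -/
lemma exists_finset_zeros_deriv {F F' : ℝ → ℝ} (hF : ∀ x, HasDerivAt F (F' x) x)
    (hlim : Tendsto F atTop (𝓝 0)) (s : Finset ℝ) (hs : ∀ x ∈ s, 0 ≤ x ∧ F x = 0) :
    ∃ t : Finset ℝ, t.card = s.card ∧ ∀ x ∈ t, 0 < x ∧ F' x = 0 := by
  -- The zero attached to `x` lies before the next point of `s`, which makes the choice strictly
  -- monotone, hence injective.
  have key : ∀ x ∈ s, ∃ y, x < y ∧ F' y = 0 ∧ ∀ z ∈ s, x < z → y < z := by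
    intro x hx
    by_cases hex : ∃ z ∈ s, x < z
    · obtain ⟨z, hz, hxz, hmin⟩ := Finset.exists_next_right hex
      obtain ⟨y, hy, hy0⟩ := exists_hasDerivAt_eq_zero hxz
        (fun v _ => (hF v).continuousAt.continuousWithinAt) ((hs x hx).2.trans (hs z hz).2.symm)
        (fun v _ => hF v)
      exact ⟨y, hy.1, hy0, fun v hv hxv => hy.2.trans_le (hmin v hv hxv)⟩
    · obtain ⟨y, hy, hy0⟩ := exists_hasDerivAt_eq_zero_Ioi hF (hs x hx).2 hlim
      exact ⟨y, hy, hy0, fun z hz hxz => absurd ⟨z, hz, hxz⟩ hex⟩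
  choose! y hxy hy0 hyz using key
  have hmono : StrictMonoOn y s := fun x hx z hz hxz => (hyz x hx z hz hxz).trans (hxy z hz)
  refine ⟨s.image y, Finset.card_image_of_injOn hmono.injOn, ?_⟩
  intro v hv
  obtain ⟨x, hx, rfl⟩ := Finset.mem_image.1 hv
  exact ⟨(hs x hx).1.trans_lt (hxy x hx), hy0 x hx⟩

open Real in
-- The new zero comes from `sinh 0 = 0`: inserting `0` gives `n + 1` zeros before the first Rolle
-- step, and decay at infinity (from `m ≠ 0`) keeps this number through both steps.
lemma exists_finset_zeros_tanhOp_iterate {m : ℕ} (hm : m ≠ 0) (f : ℝ[X]) (n : ℕ) :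
    ∃ t : Finset ℝ, t.card = n ∧
      ∀ u ∈ t, 0 < u ∧ ((tanhOp m)^[n] f).eval (tanh u ^ 2) = 0 := by
  induction n with
  | zero => exact ⟨∅, rfl, by simp⟩
  | succ n ih =>
    obtain ⟨s, hs, hs0⟩ := ih
    rw [Function.iterate_succ_apply']
    set g := (tanhOp m)^[n] f
    have h0 : (0 : ℝ) ∉ s := fun h => (hs0 0 h).1.false
    obtain ⟨t, ht, ht0⟩ := exists_finset_zeros_deriv (hasDerivAt_tanhWeight_mul m g)
      (tendsto_tanhWeight_mul_atTop hm g) (insert 0 s) (by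
        intro x hx
        rcases Finset.mem_insert.1 hx with rfl | hx
        · simp
        · exact ⟨(hs0 x hx).1.le, by rw [(hs0 x hx).2, mul_zero]⟩)
    obtain ⟨t', ht', ht0'⟩ := exists_finset_zeros_deriv (hasDerivAt_flux m g)
      (tendsto_flux_atTop hm _) t fun x hx => ⟨(ht0 x hx).1.le, (ht0 x hx).2⟩
    refine ⟨t', by rw [ht', ht, Finset.card_insert_of_notMem h0, hs], fun u hu => ?_⟩
    obtain ⟨hu0, hu1⟩ := ht0' u hu
    refine ⟨hu0, (mul_eq_zero.1 hu1).resolve_left ?_⟩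
    exact (div_pos (sinh_pos_iff.2 hu0) (pow_pos (cosh_pos u) _)).ne'

/-- Dividing out the real roots leaves a cofactor of degree at most one. -/
lemma splits_of_natDegree_le_card_roots_add_one {f : ℝ[X]}
    (h : f.natDegree ≤ Multiset.card f.roots + 1) : f.Splits := by
  obtain ⟨q, hq, hdeg, -⟩ := exists_prod_multiset_X_sub_C_mul f
  rw [← hq]
  refine Splits.mul (Splits.multisetProd fun p hp => ?_) (Splits.of_natDegree_le_one (by omega))
  obtain ⟨x, -, rfl⟩ := Multiset.mem_map.1 hp
  exact Splits.X_sub_C x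

lemma injOn_tanh_sq : Set.InjOn (fun u => Real.tanh u ^ 2) (Set.Ioi 0) := by
  intro u hu v hv h
  have pos : ∀ x : ℝ, 0 < x → 0 < Real.tanh x := fun x hx => by
    rw [Real.tanh_eq_sinh_div_cosh]
    exact div_pos (Real.sinh_pos_iff.2 hx) (Real.cosh_pos x)
  exact Real.tanh_injective ((pow_left_inj₀ (pos u hu).le (pos v hv).le two_ne_zero).1 h)

lemma card_le_card_roots_of_tanh_sq {f : ℝ[X]} (hf : f ≠ 0) (t : Finset ℝ)
    (ht : ∀ u ∈ t, 0 < u ∧ f.eval (Real.tanh u ^ 2) = 0) : t.card ≤ Multiset.card f.roots := by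
  classical
  rw [← Finset.card_image_of_injOn (f := fun u => Real.tanh u ^ 2) (s := t)
    (injOn_tanh_sq.mono fun u hu => (ht u hu).1)]
  refine (Finset.card_le_card (t := f.roots.toFinset) ?_).trans (Multiset.toFinset_card_le _)
  intro x hx
  obtain ⟨u, hu, rfl⟩ := Finset.mem_image.1 hx
  rw [Multiset.mem_toFinset, mem_roots hf]
  exact (ht u hu).2

lemma splits_tanhOp_iterate {m : ℕ} (hm : m ≠ 0) {f : ℝ[X]} (hf : f ≠ 0) (hdeg : f.natDegree ≤ 1)
    (n : ℕ) : ((tanhOp m)^[n] f).Splits := by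
  obtain ⟨hne, hd⟩ := tanhOp_iterate_ne_zero m n hf
  obtain ⟨t, ht, ht0⟩ := exists_finset_zeros_tanhOp_iterate hm f n
  apply splits_of_natDegree_le_card_roots_add_one
  have := card_le_card_roots_of_tanh_sq hne t ht0
  omega

end Rolle

/-! ### Lattice sums over the poles -/

noncomputable section LatticeSum

open Real Complex

/-- The vector from the pole `i (π / 2 + 2 π n)` to `u`, rotated by a quarter turn. -/
def poleVec (n : ℤ) (u : ℝ) : ℂ := ((π / 2 + 2 * π * n : ℝ) : ℂ) + u * I

/-- The sum of the `K`-th inverse powers of the vectors `poleVec n u`. -/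
def latticeSum (K : ℕ) (u : ℝ) : ℂ := ∑' n : ℤ, (poleVec n u ^ K)⁻¹

lemma pole_ne_zero (n : ℤ) : π / 2 + 2 * π * n ≠ 0 := by
  intro h
  have h1 : (1 + 4 * n : ℝ) = 0 := by
    have := pi_pos
    have h2 : π * (1 + 4 * n) = 0 := by linarith
    exact (mul_eq_zero.1 h2).resolve_left this.ne'
  have h3 : (1 + 4 * n : ℤ) = 0 := by exact_mod_cast h1
  omega

lemma abs_pole_le_norm_poleVec (n : ℤ) (u : ℝ) : |π / 2 + 2 * π * n| ≤ ‖poleVec n u‖ := by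
  have h := abs_re_le_norm (poleVec n u)
  simpa [poleVec] using h

lemma poleVec_ne_zero (n : ℤ) (u : ℝ) : poleVec n u ≠ 0 :=
  norm_pos_iff.1 ((abs_pos.2 (pole_ne_zero n)).trans_le (abs_pole_le_norm_poleVec n u))

lemma normSq_poleVec (n : ℤ) (u : ℝ) : ‖poleVec n u‖ ^ 2 = (π / 2 + 2 * π * n) ^ 2 + u ^ 2 := by
  rw [← normSq_eq_norm_sq, normSq_apply]
  simp [poleVec]
  ring

lemma summable_inv_abs_pole {K : ℕ} (hK : 2 ≤ K) :
    Summable fun n : ℤ => (|π / 2 + 2 * π * n| ^ K)⁻¹ := by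
  -- Each pole is `2π (1/4 + n)`.
  have h := (EisensteinSeries.linear_right_summable (1 / 4) 1 (k := K) (by exact_mod_cast hK)).norm
  refine (h.mul_left ((2 * π) ^ K)⁻¹).congr fun n => ?_
  rw [norm_inv, ← mul_inv, zpow_natCast, norm_pow, ← mul_pow]
  congr 2
  rw [show ((1 : ℤ) : ℂ) * (1 / 4) + n = ((1 / 4 + n : ℝ) : ℂ) by push_cast; ring, norm_real,
    norm_eq_abs]
  nth_rewrite 1 [← abs_of_pos two_pi_pos]
  rw [← abs_mul]
  congr 1
  ring

lemma norm_inv_poleVec_pow_le (n : ℤ) (u : ℝ) (K : ℕ) :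
    ‖(poleVec n u ^ K)⁻¹‖ ≤ (|π / 2 + 2 * π * n| ^ K)⁻¹ := by
  rw [norm_inv, norm_pow]
  have := abs_pos.2 (pole_ne_zero n)
  gcongr
  exact abs_pole_le_norm_poleVec n u

lemma summable_inv_poleVec_pow {K : ℕ} (hK : 2 ≤ K) (u : ℝ) :
    Summable fun n : ℤ => (poleVec n u ^ K)⁻¹ :=
  (summable_inv_abs_pole hK).of_norm_bounded fun n => norm_inv_poleVec_pow_le n u K

lemma hasDerivAt_inv_poleVec_pow (n : ℤ) (K : ℕ) (u : ℝ) :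
    HasDerivAt (fun u => (poleVec n u ^ K)⁻¹) (-I * K * (poleVec n u ^ (K + 1))⁻¹) u := by
  have h1 : HasDerivAt (fun u => poleVec n u) (1 * I) u :=
    ((hasDerivAt_id u).ofReal_comp.mul_const I).const_add _
  have h0 := poleVec_ne_zero n u
  refine ((h1.fun_pow K).fun_inv (pow_ne_zero K h0)).congr_deriv ?_
  rcases K with _ | K
  · simp
  · simp only [Nat.add_one_sub_one]
    field_simp
    ring

lemma hasDerivAt_latticeSum {K : ℕ} (hK : 2 ≤ K) (u : ℝ) :
    HasDerivAt (latticeSum K) (-I * K * latticeSum (K + 1) u) u := by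
  have h := hasDerivAt_tsum (y₀ := 0)
    ((summable_inv_abs_pole (K := K + 1) (by omega)).mul_left (K : ℝ))
    (fun n u => hasDerivAt_inv_poleVec_pow n K u) (fun n u => by
      rw [norm_mul, norm_mul, norm_neg, norm_I, one_mul, Complex.norm_natCast]
      gcongr
      exact norm_inv_poleVec_pow_le n u (K + 1)) (summable_inv_poleVec_pow hK 0) u
  rwa [tsum_mul_left] at h

lemma hasDerivAt_im_latticeSum {K : ℕ} (hK : 2 ≤ K) (u : ℝ) :
    HasDerivAt (fun u => (latticeSum K u).im) (-(K * (latticeSum (K + 1) u).re)) u := by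
  refine ((imCLM.hasFDerivAt).comp_hasDerivAt u (hasDerivAt_latticeSum hK u)).congr_deriv ?_
  simp

lemma hasDerivAt_re_latticeSum {K : ℕ} (hK : 2 ≤ K) (u : ℝ) :
    HasDerivAt (fun u => (latticeSum K u).re) (K * (latticeSum (K + 1) u).im) u := by
  refine ((reCLM.hasFDerivAt).comp_hasDerivAt u (hasDerivAt_latticeSum hK u)).congr_deriv ?_
  simp

/-- This is the partial fraction expansion of `π cot(πz)`, differentiated once. -/
lemma tsum_inv_add_int_sq {z : ℂ} (hz : 0 < z.im) :
    ∑' n : ℤ, 1 / (z + n) ^ 2 = π ^ 2 / Complex.sin (π * z) ^ 2 := by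
  have hz' : z ∈ UpperHalfPlane.upperHalfPlaneSet := hz
  have h := iteratedDerivWithin_cot_pi_mul_eq_mul_tsum_div_pow le_rfl hz'
  have hs : Complex.sin (π * z) ≠ 0 :=
    sin_pi_mul_ne_zero (UpperHalfPlane.coe_mem_integerComplement ⟨z, hz⟩)
  rw [iteratedDerivWithin_one,
    derivWithin_of_isOpen UpperHalfPlane.isOpen_upperHalfPlaneSet hz'] at h
  have hm : HasDerivAt (fun x : ℂ => π * x) π z := by
    simpa using (hasDerivAt_id z).const_mul (π : ℂ)
  have hd : HasDerivAt (fun x : ℂ => π * Complex.cot (π * x)) (-(π ^ 2 / Complex.sin (π * z) ^ 2))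
      z := by
    have := (((Complex.hasDerivAt_cos _).comp z hm).div ((Complex.hasDerivAt_sin _).comp z hm)
      hs).const_mul (π : ℂ)
    refine this.congr_deriv ?_
    simp only [Function.comp_apply]
    have := Complex.sin_sq_add_cos_sq (π * z)
    field_simp
    linear_combination (-1 : ℂ) * this
  rw [hd.deriv] at h
  simp only [pow_one, Nat.factorial_one, Nat.cast_one, mul_one, neg_mul, one_mul] at h
  exact (neg_injective h).symm

lemma latticeSum_two {u : ℝ} (hu : 0 < u) :
    latticeSum 2 u = 1 / 2 * (1 - Real.sinh u * I) / Real.cosh u ^ 2 := by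
  -- Chosen so that `poleVec n u = 2π (z + n)`; then `2πz = π/2 + iu` and `sin²(πz) = (1 + i sinh u)
  -- / 2`.
  set z : ℂ := 1 / 4 + u / (2 * π) * I with hz
  have hpi : (π : ℂ) ≠ 0 := by exact_mod_cast pi_ne_zero
  have hzim : 0 < z.im := by
    have e : z = ((1 / 4 : ℝ) : ℂ) + ((u / (2 * π) : ℝ) : ℂ) * I := by rw [hz]; push_cast; ring
    rw [e, add_im, ofReal_im, im_ofReal_mul, I_im]
    positivity
  have h1 : latticeSum 2 u = 1 / (2 * π) ^ 2 * ∑' n : ℤ, 1 / (z + n) ^ 2 := by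
    rw [latticeSum, ← tsum_mul_left]
    congr 1
    funext n
    rw [one_div_mul_one_div, ← mul_pow, one_div]
    congr 2
    rw [hz, poleVec]
    push_cast
    field_simp
    ring
  rw [h1, tsum_inv_add_int_sq hzim]
  have h2 : Complex.sin (π * z) ^ 2 = 1 / 2 * (1 + Real.sinh u * I) := by
    have e : Complex.cos (2 * (π * z)) = -(Real.sinh u * I) := by
      rw [show 2 * (π * z) = u * I + π / 2 by rw [hz]; field_simp; ring, Complex.cos_add_pi_div_two,
        Complex.sin_mul_I, ofReal_sinh]
    rw [Complex.sin_sq, Complex.cos_sq, e]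
    ring
  rw [h2]
  have h3 : (1 + Real.sinh u * I) * (1 - Real.sinh u * I) = (Real.cosh u : ℂ) ^ 2 := by
    have : (Real.cosh u : ℂ) ^ 2 = Real.sinh u ^ 2 + 1 := by exact_mod_cast Real.cosh_sq u
    rw [this]
    linear_combination (-(Real.sinh u : ℂ) ^ 2) * I_sq
  have h4 : (Real.cosh u : ℂ) ≠ 0 := by exact_mod_cast (Real.cosh_pos u).ne'
  have h5 : 1 + Real.sinh u * I ≠ 0 := by
    intro h
    rw [h, zero_mul] at h3
    exact pow_ne_zero 2 h4 h3.symm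
  rw [← h3]
  have h6 : 1 - Real.sinh u * I ≠ 0 := by
    intro h
    rw [h, mul_zero] at h3
    exact pow_ne_zero 2 h4 h3.symm
  field_simp

lemma im_latticeSum_two {u : ℝ} (hu : 0 < u) :
    (latticeSum 2 u).im = -(1 / 2) * (Real.sinh u / Real.cosh u ^ 2) := by
  rw [latticeSum_two hu, show 1 / 2 * (1 - Real.sinh u * I) / (Real.cosh u : ℂ) ^ 2 =
    ((1 / 2 / Real.cosh u ^ 2 : ℝ) : ℂ) +
      ((-(1 / 2) * (Real.sinh u / Real.cosh u ^ 2) : ℝ) : ℂ) * I by push_cast; ring]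
  rw [add_im, ofReal_im, im_ofReal_mul, I_im]
  ring

lemma re_latticeSum_two {u : ℝ} (hu : 0 < u) :
    (latticeSum 2 u).re = 1 / 2 * (1 / Real.cosh u ^ 2) := by
  rw [latticeSum_two hu, show 1 / 2 * (1 - Real.sinh u * I) / (Real.cosh u : ℂ) ^ 2 =
    ((1 / 2 * (1 / Real.cosh u ^ 2) : ℝ) : ℂ) +
      ((-(1 / 2) * (Real.sinh u / Real.cosh u ^ 2) : ℝ) : ℂ) * I by push_cast; ring]
  rw [add_re, ofReal_re, re_ofReal_mul, I_re]
  ring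

/-- The closed forms are proved only for `u > 0`; this open condition suffices for differentiating
them. -/
lemma HasDerivAt.eq_of_eqOn_Ioi {F G : ℝ → ℝ} {F' G' u : ℝ} (hu : 0 < u)
    (hFG : ∀ v, 0 < v → F v = G v) (hF : HasDerivAt F F' u) (hG : HasDerivAt G G' u) : F' = G' :=
  hF.unique (hG.congr_of_eventuallyEq (by
    filter_upwards [eventually_gt_nhds hu] with v hv using hFG v hv))

/-- Differentiate the closed form of the real part for exponent `2`. -/
lemma im_latticeSum_three {u : ℝ} (hu : 0 < u) :
    (latticeSum 3 u).im = -(1 / 2) * (Real.sinh u / Real.cosh u ^ 3) := by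
  have h := HasDerivAt.eq_of_eqOn_Ioi hu (fun v hv => re_latticeSum_two hv)
    (hasDerivAt_re_latticeSum le_rfl u) ((hasDerivAt_inv_cosh_pow 2 u).const_mul (1 / 2))
  have hc := (Real.cosh_pos u).ne'
  rw [Real.tanh_eq_sinh_div_cosh] at h
  norm_num at h
  rw [show (latticeSum 3 u).im = 2 * (latticeSum 3 u).im / 2 by ring, h]
  field_simp

/-- The factors in `tanhWeight_mul_eval_iterate`. -/
def latticeCoeff (m : ℕ) : ℕ → ℝ
  | 0 => -2
  | n + 1 => -((m + 1 + 2 * n) * (m + 2 + 2 * n)) * latticeCoeff m n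

lemma latticeCoeff_ne_zero (m n : ℕ) : latticeCoeff m n ≠ 0 := by
  induction n with
  | zero => simp [latticeCoeff]
  | succ n ih =>
    rw [latticeCoeff]
    refine mul_ne_zero (neg_ne_zero.2 ?_) ih
    positivity

/-- Two derivatives turn the imaginary part with exponent `K` into `-K(K + 1)` times that with
exponent `K + 2`; `latticeCoeff` collects these factors, starting from `-2` to cancel the `-1/2` in
`h0`. -/
lemma tanhWeight_mul_eval_iterate {m : ℕ} (hm : m ≠ 0)
    (h0 : ∀ u : ℝ, 0 < u →
      (latticeSum (m + 1) u).im = -(1 / 2) * (Real.sinh u / Real.cosh u ^ (m + 1)))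
    (n : ℕ) {u : ℝ} (hu : 0 < u) :
    Real.sinh u / Real.cosh u ^ (m + 1) * ((tanhOp m)^[n] 1).eval (Real.tanh u ^ 2) =
      latticeCoeff m n * (latticeSum (m + 1 + 2 * n) u).im := by
  induction n generalizing u with
  | zero =>
    simp only [Function.iterate_zero, id_eq, eval_one, latticeCoeff, mul_zero, add_zero, h0 u hu]
    ring
  | succ n ih =>
    rw [Function.iterate_succ_apply']
    set g := (tanhOp m)^[n] 1
    have h1 : ∀ v : ℝ, 0 < v → 1 / Real.cosh v ^ m * (tanhFlux m g).eval (Real.tanh v ^ 2) =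
        latticeCoeff m n * -((m + 1 + 2 * n : ℕ) * (latticeSum (m + 1 + 2 * n + 1) v).re) :=
      fun v hv => HasDerivAt.eq_of_eqOn_Ioi hv (fun v hv => ih hv)
        (hasDerivAt_tanhWeight_mul m g v)
        ((hasDerivAt_im_latticeSum (by omega) v).const_mul _)
    have h2 := HasDerivAt.eq_of_eqOn_Ioi hu h1 (hasDerivAt_flux m g u)
      (((hasDerivAt_re_latticeSum (by omega) u).const_mul _).fun_neg.const_mul _)
    rw [h2, latticeCoeff]
    push_cast
    ring_nf

end LatticeSum

/-! ### Asymptotics of the lattice sums -/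

section Asymptotics

open Real Complex

/-- The difference of the two sides is `2π² n(1 + 2n)`, and `n(1 + 2n) > 0` for every nonzero
integer. -/
lemma sq_pole_zero_lt {n : ℤ} (hn : n ≠ 0) : (π / 2) ^ 2 < (π / 2 + 2 * π * n) ^ 2 := by
  have h1 : (0 : ℝ) < n * (1 + 2 * n) := by
    have : 0 < n * (1 + 2 * n) := by
      rcases lt_or_gt_of_ne hn with h | h
      · exact mul_pos_of_neg_of_neg h (by omega)
      · exact mul_pos h (by omega)
    exact_mod_cast this
  have h2 := mul_pos (pow_pos pi_pos 2) h1
  nlinarith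

lemma norm_poleVec_zero_div_lt_one {n : ℤ} (hn : n ≠ 0) (u : ℝ) :
    ‖poleVec 0 u‖ / ‖poleVec n u‖ < 1 := by
  rw [div_lt_one (norm_pos_iff.2 (poleVec_ne_zero n u))]
  refine lt_of_pow_lt_pow_left₀ 2 (norm_nonneg _) ?_
  rw [normSq_poleVec, normSq_poleVec]
  have := sq_pole_zero_lt hn
  simpa using this

/-- The squared ratio `(p₀² + u²) / (pₙ² + u²)` increases with `u ≥ 0` because `p₀² ≤ pₙ²`. Its
value at `U` thus controls all of `[0, U]` uniformly. -/
lemma norm_poleVec_zero_div_mono (n : ℤ) {u U : ℝ} (hu : 0 ≤ u) (huU : u ≤ U) :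
    ‖poleVec 0 u‖ / ‖poleVec n u‖ ≤ ‖poleVec 0 U‖ / ‖poleVec n U‖ := by
  rw [div_le_div_iff₀ (norm_pos_iff.2 (poleVec_ne_zero n u))
    (norm_pos_iff.2 (poleVec_ne_zero n U))]
  refine le_of_sq_le_sq ?_ (by positivity)
  rw [mul_pow, mul_pow, normSq_poleVec, normSq_poleVec, normSq_poleVec, normSq_poleVec]
  have h1 : (π / 2) ^ 2 ≤ (π / 2 + 2 * π * n) ^ 2 := by
    rcases eq_or_ne n 0 with rfl | hn
    · simp
    · exact (sq_pole_zero_lt hn).le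
  have h2 : u ^ 2 ≤ U ^ 2 := by gcongr
  simp only [Int.cast_zero, mul_zero, add_zero]
  nlinarith [mul_nonneg (sub_nonneg.2 h1) (sub_nonneg.2 h2)]

lemma tendsto_tsum_poleVec_ratio (U : ℝ) :
    Tendsto (fun K : ℕ => ∑' n : ℤ, if n = 0 then 0 else (‖poleVec 0 U‖ / ‖poleVec n U‖) ^ K)
      atTop (𝓝 0) := by
  have h := tendsto_tsum_of_dominated_convergence (𝓕 := atTop)
    (f := fun K : ℕ => fun n : ℤ =>
      if n = 0 then (0 : ℝ) else (‖poleVec 0 U‖ / ‖poleVec n U‖) ^ K)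
    (g := fun _ => 0) ((summable_inv_abs_pole le_rfl).mul_left (‖poleVec 0 U‖ ^ 2))
    (fun n => by
      rcases eq_or_ne n 0 with rfl | hn
      · simp
      · simp only [hn, if_false]
        exact tendsto_pow_atTop_nhds_zero_of_lt_one (by positivity)
          (norm_poleVec_zero_div_lt_one hn U))
    (by
      -- The ratios are below one, so the summable square serves as dominating term for all `K ≥ 2`.
      filter_upwards [eventually_ge_atTop 2] with K hK n
      rcases eq_or_ne n 0 with rfl | hn
      · simp
        positivity
      · simp only [hn, if_false]
        rw [Real.norm_of_nonneg (by positivity)]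
        refine (pow_le_pow_of_le_one (by positivity)
          (norm_poleVec_zero_div_lt_one hn U).le hK).trans ?_
        rw [div_pow, div_eq_mul_inv]
        gcongr
        · exact pow_pos (abs_pos.2 (pole_ne_zero n)) 2
        · exact abs_pole_le_norm_poleVec n U)
  simpa using h

lemma summable_poleVec_ratio (U : ℝ) {K : ℕ} (hK : 2 ≤ K) :
    Summable fun n : ℤ => if n = 0 then 0 else (‖poleVec 0 U‖ / ‖poleVec n U‖) ^ K := by
  refine ((summable_inv_abs_pole hK).mul_left (‖poleVec 0 U‖ ^ K)).of_nonneg_of_le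
    (fun n => ?_) (fun n => ?_)
  · split_ifs <;> positivity
  · split_ifs
    · positivity
    · rw [div_pow, div_eq_mul_inv]
      gcongr
      · exact pow_pos (abs_pos.2 (pole_ne_zero n)) K
      · exact abs_pole_le_norm_poleVec n U

lemma eventually_norm_latticeSum_mul_sub_one_le (U : ℝ) {ε : ℝ} (hε : 0 < ε) :
    ∀ᶠ K : ℕ in atTop, ∀ u, 0 ≤ u → u ≤ U → ‖latticeSum K u * poleVec 0 u ^ K - 1‖ ≤ ε := by
  filter_upwards [(tendsto_tsum_poleVec_ratio U).eventually_le_const hε, eventually_ge_atTop 2]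
    with K hKε hK u hu huU
  refine le_trans ?_ hKε
  have h1 : latticeSum K u * poleVec 0 u ^ K = ∑' n : ℤ, (poleVec 0 u / poleVec n u) ^ K := by
    rw [latticeSum, ← tsum_mul_right]
    congr 1
    funext n
    rw [div_pow, div_eq_mul_inv, mul_comm]
  have h2 : Summable fun n : ℤ => (poleVec 0 u / poleVec n u) ^ K := by
    refine ((summable_inv_poleVec_pow hK u).mul_left (poleVec 0 u ^ K)).congr fun n => ?_
    rw [div_pow, div_eq_mul_inv]
  rw [h1, h2.tsum_eq_add_tsum_ite 0, div_self (poleVec_ne_zero 0 u), one_pow, add_sub_cancel_left]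
  refine tsum_of_norm_bounded (summable_poleVec_ratio U hK).hasSum fun n => ?_
  split_ifs with hn
  · simp
  · rw [norm_pow, norm_div]
    gcongr ?_ ^ K
    exact norm_poleVec_zero_div_mono n hu huU

lemma poleVec_zero_tan {φ : ℝ} (hφ : Real.cos φ ≠ 0) :
    poleVec 0 (π / 2 * Real.tan φ) = ((π / (2 * Real.cos φ) : ℝ) : ℂ) * Complex.exp (φ * I) := by
  rw [exp_mul_I, Real.tan_eq_sin_div_cos, poleVec, ← ofReal_cos, ← ofReal_sin]
  have : (Real.cos φ : ℂ) ≠ 0 := by exact_mod_cast hφ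
  push_cast
  have h : Complex.cos φ ≠ 0 := by exact_mod_cast hφ
  simp only [mul_zero, add_zero]
  field_simp

/-- Rescaled by the modulus of the dominant term, the sum is uniformly close to `exp(-iKφ)`, whose
imaginary part is `-sin(Kφ)`. -/
lemma eventually_abs_im_latticeSum_add_sin_le {Φ : ℝ} (hΦ : Φ < π / 2) {ε : ℝ} (hε : 0 < ε) :
    ∀ᶠ K : ℕ in atTop, ∀ φ, 0 ≤ φ → φ ≤ Φ →
      |(π / (2 * Real.cos φ)) ^ K * (latticeSum K (π / 2 * Real.tan φ)).im + Real.sin (K * φ)| ≤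
        ε := by
  filter_upwards [eventually_norm_latticeSum_mul_sub_one_le (π / 2 * Real.tan Φ) hε]
    with K hK φ hφ hφΦ
  have hpi := pi_pos
  have hcos : Real.cos φ ≠ 0 := (cos_pos_of_mem_Ioo ⟨by linarith, by linarith⟩).ne'
  have htan : Real.tan φ ≤ Real.tan Φ :=
    strictMonoOn_tan.monotoneOn ⟨by linarith, by linarith⟩ ⟨by linarith, hΦ⟩ hφΦ
  have h := hK (π / 2 * Real.tan φ)
    (mul_nonneg (by positivity) (tan_nonneg_of_nonneg_of_le_pi_div_two hφ (by linarith)))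
    (by gcongr)
  rw [poleVec_zero_tan hcos, mul_pow] at h
  set ρ := π / (2 * Real.cos φ)
  set Y := latticeSum K (π / 2 * Real.tan φ)
  have hexp : Complex.exp (φ * I) ^ K * Complex.exp (((-(K * φ) : ℝ) : ℂ) * I) = 1 := by
    rw [← Complex.exp_nat_mul, ← Complex.exp_add, ← Complex.exp_zero]
    congr 1
    push_cast
    ring
  have h1 : ((ρ ^ K : ℝ) : ℂ) * Y - Complex.exp (((-(K * φ) : ℝ) : ℂ) * I) =
      (Y * ((ρ : ℂ) ^ K * Complex.exp (φ * I) ^ K) - 1) *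
        Complex.exp (((-(K * φ) : ℝ) : ℂ) * I) := by
    rw [sub_mul, one_mul, ← mul_assoc Y, mul_assoc (Y * (ρ : ℂ) ^ K), hexp]
    push_cast
    ring
  have h2 : ‖((ρ ^ K : ℝ) : ℂ) * Y - Complex.exp (((-(K * φ) : ℝ) : ℂ) * I)‖ ≤ ε := by
    rwa [h1, norm_mul, norm_exp_ofReal_mul_I, mul_one]
  refine le_trans (le_of_eq ?_) ((abs_im_le_norm _).trans h2)
  rw [sub_im, im_ofReal_mul, exp_ofReal_mul_I_im, Real.sin_neg, sub_neg_eq_add]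

end Asymptotics

/-! ### Counting roots -/

section RootCount

open Real

/-- A continuous function close to `-sin (K φ)` has about `K (β - α) / π` zeros in `(α, β)`. -/
lemma exists_finset_zeros_of_near_sin {E : ℝ → ℝ} {K : ℕ} (hK : K ≠ 0) {α β : ℝ} (hα : 0 < α)
    (hE : ContinuousOn E (Set.Icc α β))
    (hsin : ∀ φ ∈ Set.Icc α β, |E φ + sin (K * φ)| ≤ 1 / 2) :
    ∃ t : Finset ℝ, (∀ φ ∈ t, φ ∈ Set.Ioo α β ∧ E φ = 0) ∧
      K * (β - α) / π - 3 ≤ t.card := by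
  have hpi := pi_pos
  have hK0 : (0 : ℝ) < K := by exact_mod_cast Nat.pos_of_ne_zero hK
  -- The points `(j + i + 1/2)π / K` are extrema of `sin(Kφ)`, where the sign of `E` is forced and
  -- alternates. The `2` subtracted in `M` absorbs the rounding in `j` and the `1/2`, so that all
  -- points with `i ≤ M` lie below `β`.
  set j := ⌈α * K / π⌉₊
  set M := ⌊K * (β - α) / π - 2⌋₊ with hM
  have hj1 : α * K / π ≤ j := Nat.le_ceil _
  have hj2 : (j : ℝ) < α * K / π + 1 := Nat.ceil_lt_add_one (by positivity)
  have hM1 : K * (β - α) / π - 2 < M + 1 := Nat.lt_floor_add_one _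
  -- A natural floor of a negative number is `0`, so the upper bound for `M` needs `M > 0`; for `M =
  -- 0` the required count is negative.
  rcases Nat.eq_zero_or_pos M with h0 | hpos
  · refine ⟨∅, by simp, ?_⟩
    rw [h0] at hM1
    simp at hM1 ⊢
    linarith
  have hM2 : (M : ℝ) ≤ K * (β - α) / π - 2 :=
    Nat.floor_le (by
      by_contra! hneg
      rw [hM, Nat.floor_of_nonpos hneg.le] at hpos
      exact hpos.false)
  set x : ℕ → ℝ := fun i => (j + i + 1 / 2) * π / K with hx
  have hxlt : ∀ i, x i < x (i + 1) := fun i => by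
    simp only [hx]
    push_cast
    gcongr
    linarith
  have hxmono : StrictMono x := strictMono_nat_of_lt_succ hxlt
  have hxα : ∀ i, α < x i := fun i => by
    simp only [hx]
    rw [lt_div_iff₀ hK0, ← div_lt_iff₀ hpi]
    have : (0 : ℝ) ≤ i := i.cast_nonneg
    linarith
  have hxβ : ∀ i, i ≤ M → x i < β := fun i hi => by
    simp only [hx]
    rw [div_lt_iff₀ hK0, ← lt_div_iff₀ hpi]
    have h1 : (i : ℝ) ≤ M := by exact_mod_cast hi
    have h2 : K * (β - α) / π = β * K / π - α * K / π := by ring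
    linarith
  have hsgn : ∀ i, i ≤ M → (-1) ^ (j + i) * E (x i) < 0 := fun i hi => by
    have h1 := hsin (x i) ⟨(hxα i).le, (hxβ i hi).le⟩
    have h2 : sin (K * x i) = (-1) ^ (j + i) := by
      rw [show K * x i = π / 2 + (j + i : ℕ) * π by simp only [hx]; push_cast; field_simp; ring,
        sin_add_nat_mul_pi, sin_pi_div_two, mul_one]
    rw [h2, abs_le] at h1
    rcases neg_one_pow_eq_or ℝ (j + i) with h | h <;> rw [h] at h1 ⊢ <;> linarith [h1.1, h1.2]
  have key : ∀ i, i < M → ∃ y ∈ Set.Ioo (x i) (x (i + 1)), E y = 0 := fun i hi => by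
    have h1 := hsgn i hi.le
    have h2 := hsgn (i + 1) hi
    have hc : ContinuousOn E (Set.Icc (x i) (x (i + 1))) :=
      hE.mono (Set.Icc_subset_Icc (hxα i).le (hxβ (i + 1) hi).le)
    rw [← add_assoc, pow_succ] at h2
    rcases neg_one_pow_eq_or ℝ (j + i) with h | h <;> rw [h] at h1 h2
    · exact intermediate_value_Ioo (hxlt i).le hc ⟨by linarith, by linarith⟩
    · exact intermediate_value_Ioo' (hxlt i).le hc ⟨by linarith, by linarith⟩
  choose! y hy hy0 using key
  have hymono : StrictMonoOn y (Finset.range M) := by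
    intro i hi k hk hik
    have hi' := Finset.mem_range.1 hi
    have hk' := Finset.mem_range.1 hk
    exact (hy i hi').2.trans ((hxmono.monotone hik).trans_lt (hy k hk').1)
  refine ⟨(Finset.range M).image y, ?_, ?_⟩
  · intro φ hφ
    obtain ⟨i, hi, rfl⟩ := Finset.mem_image.1 hφ
    have hi' := Finset.mem_range.1 hi
    exact ⟨⟨(hxα i).trans (hy i hi').1, (hy i hi').2.trans (hxβ (i + 1) hi')⟩, hy0 i hi'⟩
  · rw [Finset.card_image_of_injOn hymono.injOn, Finset.card_range]
    linarith

/-- A combination of two consecutive iterates of `tanhOp m` on the constant `1`. -/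
noncomputable def iterComb (m : ℕ) (a b : ℝ) (n : ℕ) : ℝ[X] :=
  C a * (tanhOp m)^[n + 1] 1 + C b * (tanhOp m)^[n] 1

lemma eventually_abs_iterComb_add_sin_le {m : ℕ} (hm : m ≠ 0)
    (h0 : ∀ u : ℝ, 0 < u →
      (latticeSum (m + 1) u).im = -(1 / 2) * (sinh u / cosh u ^ (m + 1)))
    {a : ℝ} (ha : a ≠ 0) (b : ℝ) {Φ : ℝ} (hΦ : Φ < π / 2) :
    ∀ᶠ n : ℕ in atTop, ∀ φ, 0 < φ → φ ≤ Φ →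
      |(π / (2 * cos φ)) ^ (m + 3 + 2 * n) / (a * latticeCoeff m (n + 1)) *
        (sinh (π / 2 * tan φ) / cosh (π / 2 * tan φ) ^ (m + 1) *
          (iterComb m a b n).eval (tanh (π / 2 * tan φ) ^ 2)) +
        sin ((m + 3 + 2 * n : ℕ) * φ)| ≤ 1 / 2 := by
  have hpi := pi_pos
  have hev := eventually_abs_im_latticeSum_add_sin_le hΦ (ε := 1 / 4) (by norm_num)
  have htop : ∀ k : ℕ, Tendsto (fun n : ℕ => k + 2 * n) atTop atTop := fun k =>
    tendsto_atTop_mono (fun n => by simp only [id]; omega) tendsto_id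
  -- This bounds the numerator of the lower iterate's relative contribution uniformly in `φ ≤ Φ`;
  -- the last factor `2` bounds `|ρ ^ (m + 1 + 2n) M'| ≤ 1 + 1/4`.
  set r := |b / a| * (π / (2 * cos Φ)) ^ 2 * 2 with hr
  have hsmall : ∀ᶠ n : ℕ in atTop, r / ((m + 1 + 2 * n) * (m + 2 + 2 * n) : ℝ) ≤ 1 / 4 := by
    filter_upwards [eventually_ge_atTop ⌈4 * r⌉₊] with n hn
    have h1 : 4 * r ≤ n := (Nat.le_ceil _).trans (by exact_mod_cast hn)
    have hm0 : (0 : ℝ) ≤ m := m.cast_nonneg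
    have hn0 : (0 : ℝ) ≤ n := n.cast_nonneg
    rw [div_le_iff₀ (by positivity)]
    nlinarith [mul_nonneg hm0 hn0, mul_nonneg hn0 hn0, mul_nonneg hm0 hm0]
  filter_upwards [(htop (m + 3)).eventually hev, (htop (m + 1)).eventually hev, hsmall]
    with n h1 h2 h3 φ hφ hφΦ
  have hcos : 0 < cos φ := cos_pos_of_mem_Ioo ⟨by linarith, by linarith⟩
  have hcosΦ : 0 < cos Φ := cos_pos_of_mem_Ioo ⟨by linarith, by linarith⟩
  have hu : 0 < π / 2 * tan φ :=
    mul_pos (by positivity) (tan_pos_of_pos_of_lt_pi_div_two hφ (by linarith))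
  specialize h1 φ hφ.le hφΦ
  specialize h2 φ hφ.le hφΦ
  have hcn := latticeCoeff_ne_zero m n
  have e1 := tanhWeight_mul_eval_iterate hm h0 (n + 1) hu
  have e2 := tanhWeight_mul_eval_iterate hm h0 n hu
  rw [show m + 1 + 2 * (n + 1) = m + 3 + 2 * n by ring] at e1
  set ρ := π / (2 * cos φ) with hρ
  set u := π / 2 * tan φ
  set M := (latticeSum (m + 3 + 2 * n) u).im
  set M' := (latticeSum (m + 1 + 2 * n) u).im
  set w := sinh u / cosh u ^ (m + 1)
  have hq : (0 : ℝ) < (m + 1 + 2 * n) * (m + 2 + 2 * n) := by positivity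
  have key : ρ ^ (m + 3 + 2 * n) / (a * latticeCoeff m (n + 1)) *
      (w * (iterComb m a b n).eval (tanh u ^ 2)) =
      ρ ^ (m + 3 + 2 * n) * M -
        b / a * ρ ^ 2 * (ρ ^ (m + 1 + 2 * n) * M') / ((m + 1 + 2 * n) * (m + 2 + 2 * n)) := by
    rw [iterComb, eval_add, eval_mul, eval_mul, eval_C, eval_C,
      show ∀ p q : ℝ, w * (a * p + b * q) = a * (w * p) + b * (w * q) from fun p q => by ring,
      e1, e2, latticeCoeff, show m + 3 + 2 * n = m + 1 + 2 * n + 2 by ring]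
    have := hq.ne'
    field_simp
    ring
  rw [key]
  have hM' : |ρ ^ (m + 1 + 2 * n) * M'| ≤ 2 := by
    rw [abs_le] at h2 ⊢
    have := sin_le_one ((m + 1 + 2 * n : ℕ) * φ)
    have := neg_one_le_sin ((m + 1 + 2 * n : ℕ) * φ)
    constructor <;> linarith [h2.1, h2.2]
  have hρΦ : ρ ^ 2 ≤ (π / (2 * cos Φ)) ^ 2 := by
    have : cos Φ ≤ cos φ := cos_le_cos_of_nonneg_of_le_pi hφ.le (by linarith) hφΦ
    rw [hρ]
    gcongr
  have h4 : |b / a * ρ ^ 2 * (ρ ^ (m + 1 + 2 * n) * M') / ((m + 1 + 2 * n) * (m + 2 + 2 * n))| ≤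
      1 / 4 := by
    refine le_trans ?_ h3
    rw [abs_div, abs_of_pos hq, abs_mul, abs_mul, abs_of_nonneg (sq_nonneg ρ)]
    rw [hr]
    gcongr
  rw [abs_le] at h1 h4 ⊢
  constructor <;> linarith [h1.1, h1.2, h4.1, h4.2]

/-- The parametrization of `(0, 1)` in which the limiting distribution is uniform. -/
noncomputable def tanhSqTan (φ : ℝ) : ℝ := tanh (π / 2 * tan φ) ^ 2

lemma tanh_pos {u : ℝ} (hu : 0 < u) : 0 < tanh u := by
  rw [tanh_eq_sinh_div_cosh]
  exact div_pos (sinh_pos_iff.2 hu) (cosh_pos u)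

lemma tanhSqTan_strictMonoOn : StrictMonoOn tanhSqTan (Set.Ioo 0 (π / 2)) := by
  intro φ hφ ψ hψ h
  have hpi := pi_pos
  have h1 : tan φ < tan ψ :=
    strictMonoOn_tan ⟨by linarith [hφ.1], hφ.2⟩ ⟨by linarith [hψ.1], hψ.2⟩ h
  have h2 : 0 < tan φ := tan_pos_of_pos_of_lt_pi_div_two hφ.1 hφ.2
  have h3 : π / 2 * tan φ < π / 2 * tan ψ := by gcongr
  have h4 : tanh (π / 2 * tan φ) < tanh (π / 2 * tan ψ) := by
    by_contra! hle
    have := strictMonoOn_artanh.monotoneOn ⟨neg_one_lt_tanh _, tanh_lt_one _⟩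
      ⟨neg_one_lt_tanh _, tanh_lt_one _⟩ hle
    rw [artanh_tanh, artanh_tanh] at this
    linarith
  exact pow_lt_pow_left₀ h4 (tanh_pos (by positivity)).le two_ne_zero

lemma eventually_exists_finset_roots_iterComb {m : ℕ} (hm : m ≠ 0)
    (h0 : ∀ u : ℝ, 0 < u →
      (latticeSum (m + 1) u).im = -(1 / 2) * (sinh u / cosh u ^ (m + 1)))
    {a : ℝ} (ha : a ≠ 0) (b : ℝ) {α β : ℝ} (hα : 0 < α) (hαβ : α < β) (hβ : β < π / 2) :
    ∀ᶠ n : ℕ in atTop, ∃ t : Finset ℝ,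
      (∀ x ∈ t, x ∈ Set.Ioo (tanhSqTan α) (tanhSqTan β) ∧ (iterComb m a b n).eval x = 0) ∧
      (2 * n : ℝ) * (β - α) / π - 3 ≤ t.card := by
  have hpi := pi_pos
  filter_upwards [eventually_abs_iterComb_add_sin_le hm h0 ha b hβ] with n hn
  have hcos : ∀ φ ∈ Set.Icc α β, cos φ ≠ 0 := fun φ hφ =>
    (cos_pos_of_mem_Ioo ⟨by linarith [hφ.1], by linarith [hφ.2]⟩).ne'
  have htan : ContinuousOn (fun φ => π / 2 * tan φ) (Set.Icc α β) :=
    continuousOn_const.mul (continuousOn_tan.mono hcos)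
  have hcont : ContinuousOn (fun φ => (π / (2 * cos φ)) ^ (m + 3 + 2 * n) /
      (a * latticeCoeff m (n + 1)) * (sinh (π / 2 * tan φ) / cosh (π / 2 * tan φ) ^ (m + 1) *
          (iterComb m a b n).eval (tanh (π / 2 * tan φ) ^ 2))) (Set.Icc α β) := by
    refine ContinuousOn.mul ?_ ?_
    · refine ContinuousOn.div_const (ContinuousOn.pow (ContinuousOn.div continuousOn_const
        (by fun_prop) fun φ hφ => ?_) _) _
      exact mul_ne_zero two_ne_zero (hcos φ hφ)
    · have : Continuous fun u => sinh u / cosh u ^ (m + 1) *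
          (iterComb m a b n).eval (tanh u ^ 2) :=
        continuous_iff_continuousAt.2 fun u => (hasDerivAt_tanhWeight_mul m _ u).continuousAt
      exact this.comp_continuousOn htan
  obtain ⟨t, ht, hcard⟩ := exists_finset_zeros_of_near_sin (K := m + 3 + 2 * n) (by omega) hα hcont
    fun φ hφ => hn φ (hα.trans_le hφ.1) hφ.2
  have hsub : (t : Set ℝ) ⊆ Set.Ioo 0 (π / 2) := fun φ hφ =>
    ⟨hα.trans (ht φ hφ).1.1, (ht φ hφ).1.2.trans hβ⟩
  have hinj : Set.InjOn tanhSqTan t := tanhSqTan_strictMonoOn.injOn.mono hsub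
  refine ⟨t.image tanhSqTan, ?_, ?_⟩
  · intro x hx
    obtain ⟨φ, hφ, rfl⟩ := Finset.mem_image.1 hx
    obtain ⟨hφ1, hφ0⟩ := ht φ hφ
    have hφ2 : φ ∈ Set.Ioo 0 (π / 2) := ⟨hα.trans hφ1.1, hφ1.2.trans hβ⟩
    refine ⟨⟨tanhSqTan_strictMonoOn ⟨hα, hαβ.trans hβ⟩ hφ2 hφ1.1,
      tanhSqTan_strictMonoOn hφ2 ⟨hα.trans hαβ, hβ⟩ hφ1.2⟩, ?_⟩
    have hu : 0 < π / 2 * tan φ :=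
      mul_pos (by positivity) (tan_pos_of_pos_of_lt_pi_div_two hφ2.1 hφ2.2)
    have h1 : (π / (2 * cos φ)) ^ (m + 3 + 2 * n) / (a * latticeCoeff m (n + 1)) ≠ 0 :=
      div_ne_zero (pow_ne_zero _ (div_ne_zero hpi.ne' (mul_ne_zero two_ne_zero
        (hcos φ ⟨hφ1.1.le, hφ1.2.le⟩)))) (mul_ne_zero ha (latticeCoeff_ne_zero m _))
    have h2 : sinh (π / 2 * tan φ) / cosh (π / 2 * tan φ) ^ (m + 1) ≠ 0 :=
      (div_pos (sinh_pos_iff.2 hu) (pow_pos (cosh_pos _) _)).ne'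
    exact (mul_eq_zero.1 ((mul_eq_zero.1 hφ0).resolve_left h1)).resolve_left h2
  · rw [Finset.card_image_of_injOn hinj]
    refine le_trans ?_ hcard
    have : (2 * n : ℝ) ≤ (m + 3 + 2 * n : ℕ) := by
      push_cast
      have : (0 : ℝ) ≤ m := m.cast_nonneg
      linarith
    have : 0 ≤ β - α := by linarith
    gcongr

end RootCount

/-! ### The limiting measure -/

section LimitMeasure

open Real

/-- The inverse of `tanhSqTan`. -/
noncomputable def limitAngle (x : ℝ) : ℝ := arctan (2 / π * artanh √x)

lemma limitAngle_tanhSqTan {φ : ℝ} (hφ : φ ∈ Set.Ioo 0 (π / 2)) :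
    limitAngle (tanhSqTan φ) = φ := by
  have hpi := pi_pos
  have htan := tan_pos_of_pos_of_lt_pi_div_two hφ.1 hφ.2
  rw [limitAngle, tanhSqTan, sqrt_sq (tanh_pos (by positivity)).le, artanh_tanh,
    show 2 / π * (π / 2 * tan φ) = tan φ by field_simp, arctan_tan (by linarith [hφ.1]) hφ.2]

lemma limitAngle_mem {x : ℝ} (hx : x ∈ Set.Ioo 0 1) : limitAngle x ∈ Set.Ioo 0 (π / 2) := by
  have hpi := pi_pos
  have h1 : √x < 1 := (sqrt_lt' one_pos).2 (by simpa using hx.2)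
  have h2 := artanh_pos ⟨sqrt_pos.2 hx.1, h1⟩
  exact ⟨arctan_pos.2 (by positivity), arctan_lt_pi_div_two _⟩

lemma tanhSqTan_limitAngle {x : ℝ} (hx : x ∈ Set.Ioo 0 1) : tanhSqTan (limitAngle x) = x := by
  have hpi := pi_pos
  have h1 : √x < 1 := (sqrt_lt' one_pos).2 (by simpa using hx.2)
  rw [limitAngle, tanhSqTan, tan_arctan, show π / 2 * (2 / π * artanh √x) = artanh √x by field_simp,
    tanh_artanh ⟨by linarith [sqrt_nonneg x], h1⟩, sq_sqrt hx.1.le]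

lemma tanhSqTan_mem {φ : ℝ} (hφ : φ ∈ Set.Ioo 0 (π / 2)) : tanhSqTan φ ∈ Set.Ioo (0 : ℝ) 1 := by
  have hpi := pi_pos
  have htan := tan_pos_of_pos_of_lt_pi_div_two hφ.1 hφ.2
  exact ⟨pow_pos (tanh_pos (by positivity)) 2, tanh_sq_lt_one _⟩

lemma limitDensity_nonneg (x : ℝ) : 0 ≤ limitDensity x := by
  rw [limitDensity]
  split_ifs with h
  · have : 0 < 1 - x := by linarith [h.2]
    positivity
  · rfl

lemma limitDensity_eq_indicator : limitDensity = (Set.Ioo 0 1).indicator fun x =>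
    2 / (√x * (1 - x) * (log ((1 - √x) / (1 + √x)) ^ 2 + π ^ 2)) := by
  funext x
  simp only [limitDensity, Set.indicator, Set.mem_Ioo]

/-- The distribution function is `(2/π) · limitAngle`; writing `artanh √x` as half a logarithm turns
the derivative of `arctan` into the factor `log² + π²`. -/
lemma hasDerivAt_limitAngle {x : ℝ} (hx : x ∈ Set.Ioo 0 1) :
    HasDerivAt (fun x => 2 / π * limitAngle x) (limitDensity x) x := by
  have hpi := pi_pos
  have h0 : 0 < √x := sqrt_pos.2 hx.1
  have h1 : √x < 1 := (sqrt_lt' one_pos).2 (by simpa using hx.2)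
  have hsq := sq_sqrt hx.1.le
  have hs := hasDerivAt_sqrt hx.1.ne'
  have hd : HasDerivAt (fun x => (1 + √x) / (1 - √x))
      ((1 / (2 * √x) * (1 - √x) - (1 + √x) * -(1 / (2 * √x))) / (1 - √x) ^ 2) x :=
    (hs.const_add 1).fun_div (hs.const_sub 1) (by linarith)
  have hp : (1 + √x) / (1 - √x) ≠ 0 := (div_pos (by linarith) (by linarith)).ne'
  have hl := (((hd.log hp).const_mul (1 / 2)).const_mul (2 / π)).arctan.const_mul (2 / π)
  have hloc : (fun x => 2 / π * limitAngle x) =ᶠ[𝓝 x] fun x =>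
      2 / π * arctan (2 / π * (1 / 2 * log ((1 + √x) / (1 - √x)))) := by
    filter_upwards [isOpen_Ioo.mem_nhds hx] with y hy
    have : √y < 1 := (sqrt_lt' one_pos).2 (by simpa using hy.2)
    rw [limitAngle, artanh_eq_half_log ⟨by linarith [sqrt_nonneg y], this.le⟩]
  refine (hl.congr_of_eventuallyEq hloc).congr_deriv ?_
  have hlog : log ((1 + √x) / (1 - √x)) = -log ((1 - √x) / (1 + √x)) := by
    rw [← log_inv, inv_div]
  rw [limitDensity, if_pos ⟨hx.1, hx.2⟩, hlog]
  set L := log ((1 - √x) / (1 + √x))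
  set s := √x
  have hx' : 1 - x = (1 - s) * (1 + s) := by rw [← hsq]; ring
  have h2 : 1 - s ≠ 0 := by linarith
  have h3 : 1 + s ≠ 0 := by linarith
  have h4 : L ^ 2 + π ^ 2 ≠ 0 := by positivity
  have h5 : 1 + (2 / π * (1 / 2 * -L)) ^ 2 = (L ^ 2 + π ^ 2) / π ^ 2 := by field_simp; ring
  rw [hx', h5]
  field_simp
  ring

lemma limitMeasure_Ioc {a b : ℝ} (ha : 0 < a) (hab : a ≤ b) (hb : b < 1) :
    limitMeasure (Set.Ioc a b) = ENNReal.ofReal (2 / π * limitAngle b - 2 / π * limitAngle a) := by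
  have hsub : Set.Icc a b ⊆ Set.Ioo 0 1 := fun x hx => ⟨ha.trans_le hx.1, hx.2.trans_lt hb⟩
  have hcont : ContinuousOn (fun x => 2 / π * limitAngle x) (Set.Icc a b) := fun x hx =>
    (hasDerivAt_limitAngle (hsub hx)).continuousAt.continuousWithinAt
  have hderiv : ∀ x ∈ Set.Ioo a b,
      HasDerivAt (fun x => 2 / π * limitAngle x) (limitDensity x) x := fun x hx =>
    hasDerivAt_limitAngle (hsub (Set.Ioo_subset_Icc_self hx))
  have hint : IntegrableOn limitDensity (Set.Ioc a b) :=
    intervalIntegral.integrableOn_deriv_of_nonneg hcont hderiv fun x _ => limitDensity_nonneg x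
  rw [limitMeasure, withDensity_apply _ measurableSet_Ioc,
    ← ofReal_integral_eq_lintegral_ofReal hint (ae_of_all _ limitDensity_nonneg),
    ← intervalIntegral.integral_of_le hab,
    intervalIntegral.integral_eq_sub_of_hasDerivAt_of_le hab hcont hderiv
      ((intervalIntegrable_iff_integrableOn_Ioc_of_le hab).2 hint)]

instance limitMeasure.nullSingletonClass : NullSingletonClass limitMeasure := by
  rw [limitMeasure]
  infer_instance

lemma limitMeasure_Ioo_tanhSqTan {α β : ℝ} (hα : 0 < α) (hαβ : α < β) (hβ : β < π / 2) :
    limitMeasure (Set.Ioo (tanhSqTan α) (tanhSqTan β)) = ENNReal.ofReal (2 * (β - α) / π) := by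
  have h1 : α ∈ Set.Ioo 0 (π / 2) := ⟨hα, hαβ.trans hβ⟩
  have h2 : β ∈ Set.Ioo 0 (π / 2) := ⟨hα.trans hαβ, hβ⟩
  rw [measure_congr Ioo_ae_eq_Ioc, limitMeasure_Ioc (tanhSqTan_mem h1).1
    (tanhSqTan_strictMonoOn h1 h2 hαβ).le (tanhSqTan_mem h2).2, limitAngle_tanhSqTan h1,
    limitAngle_tanhSqTan h2]
  congr 1
  ring

lemma limitMeasure_compl : limitMeasure (Set.Ioo 0 1)ᶜ = 0 := by
  rw [limitMeasure, withDensity_apply _ measurableSet_Ioo.compl]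
  rw [setLIntegral_congr_fun (g := fun _ => 0) measurableSet_Ioo.compl fun x hx => ?_]
  · simp
  · rw [limitDensity_eq_indicator, Set.indicator_of_notMem hx, ENNReal.ofReal_zero]

lemma limitMeasure_Ioo : limitMeasure (Set.Ioo 0 1) = 1 := by
  have hpi := pi_pos
  -- The shift by `3` gives `α k < π/2 - α k` already at `k = 0`.
  set α : ℕ → ℝ := fun k => π / 2 / (k + 3) with hα
  have hα0 : ∀ k, 0 < α k := fun k => by simp only [hα]; positivity
  have hα1 : ∀ k, α k < π / 2 - α k := fun k => by
    have : α k ≤ π / 2 / 3 := by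
      simp only [hα]
      gcongr
      have : (0 : ℝ) ≤ k := k.cast_nonneg
      linarith
    linarith
  have hanti : Antitone α := fun k l hkl => by
    simp only [hα]
    gcongr
  have hlim : Tendsto α atTop (𝓝 0) :=
    (tendsto_const_nhds.div_atTop
      (tendsto_atTop_add_const_right _ _ tendsto_natCast_atTop_atTop))
  have hl : ∀ k, α k ∈ Set.Ioo 0 (π / 2) := fun k => ⟨hα0 k, by linarith [hα0 k, hα1 k]⟩
  have hr : ∀ k, π / 2 - α k ∈ Set.Ioo 0 (π / 2) := fun k =>
    ⟨by linarith [hα0 k, hα1 k], by linarith [hα0 k]⟩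
  set s : ℕ → Set ℝ := fun k => Set.Ioo (tanhSqTan (α k)) (tanhSqTan (π / 2 - α k)) with hs
  have hmono : Monotone s := fun k l hkl => Set.Ioo_subset_Ioo
    (tanhSqTan_strictMonoOn.monotoneOn (hl l) (hl k) (hanti hkl))
    (tanhSqTan_strictMonoOn.monotoneOn (hr k) (hr l) (by linarith [hanti hkl]))
  have hU : Set.Ioo (0 : ℝ) 1 = ⋃ k, s k := by
    apply Set.Subset.antisymm
    · intro x hx
      have hx' := limitAngle_mem hx
      obtain ⟨k, hk⟩ := (hlim.eventually_lt_const (u := min (limitAngle x) (π / 2 - limitAngle x))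
        (lt_min hx'.1 (by linarith [hx'.2]))).exists
      rw [lt_min_iff] at hk
      refine Set.mem_iUnion.2 ⟨k, ?_⟩
      rw [← tanhSqTan_limitAngle hx]
      exact ⟨tanhSqTan_strictMonoOn (hl k) hx' hk.1,
        tanhSqTan_strictMonoOn hx' (hr k) (by linarith [hk.2])⟩
    · refine Set.iUnion_subset fun k => Set.Ioo_subset_Ioo (tanhSqTan_mem (hl k)).1.le
        (tanhSqTan_mem (hr k)).2.le
  have h1 := tendsto_measure_iUnion_atTop (μ := limitMeasure) hmono
  rw [← hU] at h1
  refine tendsto_nhds_unique h1 ?_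
  have h2 : Tendsto (fun k => ENNReal.ofReal (2 * (π / 2 - α k - α k) / π)) atTop
      (𝓝 (ENNReal.ofReal (2 * (π / 2 - 0 - 0) / π))) :=
    ENNReal.tendsto_ofReal
      ((((tendsto_const_nhds.sub hlim).sub hlim).const_mul 2).div_const π)
  rw [show 2 * (π / 2 - 0 - 0) / π = 1 by field_simp; ring, ENNReal.ofReal_one] at h2
  refine h2.congr fun k => ?_
  rw [Function.comp_apply, hs, limitMeasure_Ioo_tanhSqTan (hα0 k) (hα1 k) (hr k).2]

instance limitMeasure.isProbabilityMeasure : IsProbabilityMeasure limitMeasure := by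
  refine ⟨?_⟩
  rw [← measure_add_measure_compl (measurableSet_Ioo (a := (0 : ℝ)) (b := 1)), limitMeasure_Ioo,
    limitMeasure_compl, add_zero]

end LimitMeasure

/-! ### Weak convergence from lower bounds on intervals -/

section WeakConvergence

variable {μ : Measure ℝ} [IsProbabilityMeasure μ] {ν : ℕ → Measure ℝ}
  [∀ n, IsProbabilityMeasure (ν n)]

/-- Inner regularity gives a compact set in `(a, b) ∩ (0, 1)` carrying almost all the mass. It sits
in some `(c, d)` to which `h` applies, so the bound extends to arbitrary `a`, `b`. -/
lemma eventually_le_measureReal_Ioo (hμ : μ (Set.Ioo 0 1) = 1)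
    (h : ∀ a b : ℝ, 0 < a → a < b → b < 1 → ∀ ε > 0, ∀ᶠ n in atTop,
      μ.real (Set.Ioo a b) - ε ≤ (ν n).real (Set.Ioo a b)) (a b : ℝ) {ε : ℝ} (hε : 0 < ε) :
    ∀ᶠ n in atTop, μ.real (Set.Ioo a b) - ε ≤ (ν n).real (Set.Ioo a b) := by
  set U := Set.Ioo a b ∩ Set.Ioo 0 1 with hUdef
  have hU : μ U = μ (Set.Ioo a b) := by
    rw [hUdef, Set.inter_comm]
    exact Measure.measure_inter_eq_of_ae ((prob_compl_eq_zero_iff measurableSet_Ioo).2 hμ)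
  by_cases hsmall : μ.real (Set.Ioo a b) ≤ ε
  · exact Eventually.of_forall fun n => (sub_nonpos.2 hsmall).trans measureReal_nonneg
  push Not at hsmall
  have hlt : ENNReal.ofReal (μ.real (Set.Ioo a b) - ε / 2) < μ U := by
    rw [hU, ENNReal.ofReal_lt_iff_lt_toReal (by linarith) (measure_ne_top _ _)]
    change _ < μ.real _
    linarith
  obtain ⟨K, hKU, hKc, hK⟩ := (isOpen_Ioo.inter isOpen_Ioo).exists_lt_isCompact hlt
  have hne : K.Nonempty := by
    by_contra hK0
    rw [Set.not_nonempty_iff_eq_empty.1 hK0, measure_empty] at hK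
    exact not_lt_bot hK
  have hc := hKU (hKc.sInf_mem hne)
  have hd := hKU (hKc.sSup_mem hne)
  obtain ⟨c, hc1, hc2⟩ := exists_between (max_lt hc.1.1 hc.2.1)
  obtain ⟨d, hd1, hd2⟩ := exists_between (lt_min hd.1.2 hd.2.2)
  rw [max_lt_iff] at hc1
  rw [lt_min_iff] at hd2
  have hKcd : K ⊆ Set.Ioo c d := fun x hx =>
    ⟨hc2.trans_le (csInf_le hKc.bddBelow hx), (le_csSup hKc.bddAbove hx).trans_lt hd1⟩
  have hcd : c < d := by
    obtain ⟨x, hx⟩ := hne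
    exact (hKcd hx).1.trans (hKcd hx).2
  have hKr : μ.real (Set.Ioo a b) - ε / 2 ≤ μ.real K :=
    (ENNReal.ofReal_le_iff_le_toReal (measure_ne_top _ _)).1 hK.le
  filter_upwards [h c d hc1.2 hcd hd2.2 (ε / 2) (by linarith)] with n hn
  have h1 : μ.real K ≤ μ.real (Set.Ioo c d) := measureReal_mono hKcd
  have h2 : (ν n).real (Set.Ioo c d) ≤ (ν n).real (Set.Ioo a b) :=
    measureReal_mono (Set.Ioo_subset_Ioo hc1.1.le hd2.1.le)
  linarith

/-- The upper bound follows by complement from the lower bounds on `(A, a)` and `(b, B)`: the three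
masses under `ν n` sum to at most one, those under `μ` to at least one. -/
lemma tendsto_measureReal_Ioc [NullSingletonClass μ] (hμ : μ (Set.Ioo 0 1) = 1)
    (h : ∀ a b : ℝ, 0 < a → a < b → b < 1 → ∀ ε > 0, ∀ᶠ n in atTop,
      μ.real (Set.Ioo a b) - ε ≤ (ν n).real (Set.Ioo a b)) {a b : ℝ} (hab : a < b) :
    Tendsto (fun n => (ν n).real (Set.Ioc a b)) atTop (𝓝 (μ.real (Set.Ioc a b))) := by
  rw [Metric.tendsto_nhds]
  intro ε hε
  set A := min a 0 - 1
  set B := max b 1 + 1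
  have hA1 : A < 0 := by linarith [min_le_right a 0]
  have hB1 : 1 < B := by linarith [le_max_right b 1]
  have hcover : 1 ≤ μ.real (Set.Ioo A a) + μ.real (Set.Ioc a b) + μ.real (Set.Ioo b B) := by
    have h1 : μ.real (Set.Ioo 0 1) = 1 := by simp [measureReal_def, hμ]
    have h2 : μ.real {a} = 0 := by simp [measureReal_def]
    have h3 : Set.Ioo 0 1 ⊆ Set.Ioo A a ∪ {a} ∪ Set.Ioc a b ∪ Set.Ioo b B := by
      intro x hx
      rcases lt_trichotomy x a with hxa | hxa | hxa
      · exact Or.inl (Or.inl (Or.inl ⟨hA1.trans hx.1, hxa⟩))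
      · exact Or.inl (Or.inl (Or.inr hxa))
      · rcases le_or_gt x b with hxb | hxb
        · exact Or.inl (Or.inr ⟨hxa, hxb⟩)
        · exact Or.inr ⟨hxb, hx.2.trans hB1⟩
    have h4 := measureReal_mono (μ := μ) h3
    have h5 := measureReal_union_le (μ := μ) (Set.Ioo A a ∪ {a} ∪ Set.Ioc a b) (Set.Ioo b B)
    have h6 := measureReal_union_le (μ := μ) (Set.Ioo A a ∪ {a}) (Set.Ioc a b)
    have h7 := measureReal_union_le (μ := μ) (Set.Ioo A a) {a}
    linarith
  filter_upwards [eventually_le_measureReal_Ioo hμ h a b (half_pos hε),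
    eventually_le_measureReal_Ioo hμ h A a (div_pos hε three_pos),
    eventually_le_measureReal_Ioo hμ h b B (div_pos hε three_pos)] with n h1 h2 h3
  have h4 : (ν n).real (Set.Ioo a b) ≤ (ν n).real (Set.Ioc a b) :=
    measureReal_mono Set.Ioo_subset_Ioc_self
  have h5 : μ.real (Set.Ioo a b) = μ.real (Set.Ioc a b) := measureReal_congr Ioo_ae_eq_Ioc
  have h6 : (ν n).real (Set.Ioo A a) + (ν n).real (Set.Ioc a b) + (ν n).real (Set.Ioo b B) ≤ 1 := by
    rw [← measureReal_union _ measurableSet_Ioc, ← measureReal_union _ measurableSet_Ioo]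
    · exact measureReal_le_one
    · rw [Set.disjoint_left]
      rintro x (hx | hx) hx'
      · exact absurd hx'.1 (by linarith [hx.2])
      · exact absurd hx'.1 (by linarith [hx.2])
    · rw [Set.disjoint_left]
      intro x hx hx'
      exact absurd hx'.1 (by linarith [hx.2])
  rw [Real.dist_eq, abs_lt]
  constructor <;> linarith

lemma tendsto_probabilityMeasure_of_le_Ioo {μ : ProbabilityMeasure ℝ} [NullSingletonClass (μ : Measure ℝ)]
    {ν : ℕ → ProbabilityMeasure ℝ} (hμ : (μ : Measure ℝ) (Set.Ioo 0 1) = 1)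
    (h : ∀ a b : ℝ, 0 < a → a < b → b < 1 → ∀ ε > 0, ∀ᶠ n in atTop,
      (μ : Measure ℝ).real (Set.Ioo a b) - ε ≤ (ν n : Measure ℝ).real (Set.Ioo a b)) :
    Tendsto ν atTop (𝓝 μ) := by
  refine (isPiSystem_Ioc (id : ℝ → ℝ) id).tendsto_probabilityMeasure_of_tendsto_of_mem ?_ ?_ ?_
  · rintro s ⟨a, b, -, rfl⟩
    exact measurableSet_Ioc
  · intro u hu x hx
    obtain ⟨ε, hε, hball⟩ := Metric.isOpen_iff.1 hu x hx
    refine ⟨Set.Ioc (x - ε / 2) (x + ε / 2), ⟨_, _, by simp; linarith, rfl⟩,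
      Ioc_mem_nhds (by linarith) (by linarith), fun y hy => hball ?_⟩
    rw [Metric.mem_ball, Real.dist_eq, abs_lt]
    constructor <;> linarith [hy.1, hy.2]
  · rintro s ⟨a, b, hab, rfl⟩
    have := tendsto_measureReal_Ioc hμ h hab
    simpa using this

end WeakConvergence

/-! ### Empirical zero measures -/

section ZeroMeasure

lemma sum_map_pointMass_apply (m : Multiset ℝ) {s : Set ℝ} (hs : MeasurableSet s)
    [DecidablePred (· ∈ s)] : (m.map pointMass).sum s = (m.countP (· ∈ s) : NNReal) := by
  induction m using Multiset.induction_on with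
  | empty => simp
  | cons x m ih =>
    rw [Multiset.map_cons, Multiset.sum_cons, FiniteMeasure.coeFn_add, Pi.add_apply, ih,
      Multiset.countP_cons, Nat.cast_add, add_comm]
    congr 1
    have : pointMass x s = (Measure.dirac x s).toNNReal := rfl
    rw [this, Measure.dirac_apply' _ hs]
    by_cases hx : x ∈ s <;> simp [hx]

lemma zeroMeasure_apply (p : ℝ[X]) {s : Set ℝ} (hs : MeasurableSet s) [DecidablePred (· ∈ s)] :
    zeroMeasure p s = (p.natDegree : NNReal)⁻¹ * p.roots.countP (· ∈ s) := by
  rw [zeroMeasure, FiniteMeasure.coeFn_smul, Pi.smul_apply, sum_map_pointMass_apply _ hs,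
    smul_eq_mul]

lemma zeroMeasure_C_mul {K : ℝ} (hK : K ≠ 0) (p : ℝ[X]) :
    zeroMeasure (C K * p) = zeroMeasure p := by
  rw [zeroMeasure, zeroMeasure, natDegree_C_mul hK, roots_C_mul _ hK]

lemma isProbabilityMeasure_zeroMeasure {p : ℝ[X]} (hp : p.Splits) (hdeg : p.natDegree ≠ 0) :
    IsProbabilityMeasure (zeroMeasure p : Measure ℝ) := by
  classical
  refine ⟨?_⟩
  rw [← FiniteMeasure.ennreal_coeFn_eq_coeFn_toMeasure, zeroMeasure_apply p MeasurableSet.univ]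
  have h : p.roots.countP (· ∈ Set.univ) = p.natDegree := by
    rw [hp.natDegree_eq_card_roots, Multiset.countP_eq_card]
    simp
  rw [h, inv_mul_cancel₀ (by exact_mod_cast hdeg), ENNReal.coe_one]

/-- Distinct roots suffice, since multiplicities only increase the right-hand side. -/
lemma card_div_natDegree_le_zeroMeasure {p : ℝ[X]} (hp : p ≠ 0) {s : Set ℝ} (hs : MeasurableSet s)
    (t : Finset ℝ) (ht : ∀ x ∈ t, x ∈ s ∧ p.eval x = 0) :
    (t.card / p.natDegree : ℝ) ≤ (zeroMeasure p : Measure ℝ).real s := by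
  classical
  have h1 : (zeroMeasure p : Measure ℝ).real s = (zeroMeasure p s : ℝ) := rfl
  rw [h1, zeroMeasure_apply p hs, NNReal.coe_mul, NNReal.coe_inv, NNReal.coe_natCast,
    NNReal.coe_natCast, div_eq_inv_mul]
  gcongr
  rw [Multiset.countP_eq_card_filter]
  refine (Finset.card_le_card (t := (p.roots.filter (· ∈ s)).toFinset) fun x hx => ?_).trans
    (Multiset.toFinset_card_le _)
  rw [Multiset.mem_toFinset, Multiset.mem_filter, mem_roots hp]
  exact ⟨(ht x hx).2, (ht x hx).1⟩

open Real in
lemma tendsto_zeroMeasure_of_many_roots {p : ℕ → ℝ[X]} (hp : ∀ n, (p n).Splits)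
    (hdeg : ∀ n, (p n).natDegree = n + 1)
    (h : ∀ α β : ℝ, 0 < α → α < β → β < π / 2 → ∀ᶠ n : ℕ in atTop, ∃ t : Finset ℝ,
      (∀ x ∈ t, x ∈ Set.Ioo (tanhSqTan α) (tanhSqTan β) ∧ (p n).eval x = 0) ∧
      (2 * n : ℝ) * (β - α) / π - 3 ≤ t.card) :
    Tendsto (fun n => zeroMeasure (p n)) atTop
      (𝓝 (ProbabilityMeasure.toFiniteMeasure ⟨limitMeasure, inferInstance⟩)) := by
  have hpi := pi_pos
  set ν : ℕ → ProbabilityMeasure ℝ := fun n =>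
    ⟨zeroMeasure (p n), isProbabilityMeasure_zeroMeasure (hp n) (by rw [hdeg]; omega)⟩ with hν
  set μ : ProbabilityMeasure ℝ := ⟨limitMeasure, inferInstance⟩
  have hatoms : NullSingletonClass (μ : Measure ℝ) := inferInstanceAs (NullSingletonClass limitMeasure)
  have key : Tendsto ν atTop (𝓝 μ) := by
    refine tendsto_probabilityMeasure_of_le_Ioo limitMeasure_Ioo fun a b ha hab hb ε hε => ?_
    have ha' : a ∈ Set.Ioo 0 1 := ⟨ha, hab.trans hb⟩
    have hb' : b ∈ Set.Ioo 0 1 := ⟨ha.trans hab, hb⟩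
    have hα := limitAngle_mem ha'
    have hβ := limitAngle_mem hb'
    have hαβ : limitAngle a < limitAngle b := by
      by_contra! hle
      have := tanhSqTan_strictMonoOn.monotoneOn hβ hα hle
      rw [tanhSqTan_limitAngle ha', tanhSqTan_limitAngle hb'] at this
      linarith
    have hm := limitMeasure_Ioo_tanhSqTan hα.1 hαβ hβ.2
    have hr := h _ _ hα.1 hαβ hβ.2
    rw [tanhSqTan_limitAngle ha', tanhSqTan_limitAngle hb'] at hm hr
    set θ := (limitAngle b - limitAngle a) / π with hθ
    have hθ0 : 0 < θ := div_pos (by linarith) hpi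
    have hμab : (μ : Measure ℝ).real (Set.Ioo a b) = 2 * θ := by
      change (limitMeasure (Set.Ioo a b)).toReal = _
      rw [hm, mul_div_assoc, ENNReal.toReal_ofReal (by positivity)]
    -- The goal `(2θ - ε)(n + 1) ≤ 2nθ - 3` amounts to `3 + 2θ ≤ ε(n + 1)`.
    filter_upwards [hr, eventually_ge_atTop ⌈(3 + 2 * θ) / ε⌉₊] with n ⟨t, ht, hcard⟩ hn
    have hne : p n ≠ 0 := fun h0 => by
      have := hdeg n
      rw [h0, natDegree_zero] at this
      omega
    refine le_trans ?_ (card_div_natDegree_le_zeroMeasure hne measurableSet_Ioo t ht)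
    have hn' : (3 + 2 * θ) / ε ≤ n := (Nat.le_ceil _).trans (by exact_mod_cast hn)
    rw [div_le_iff₀ hε] at hn'
    rw [hμab, hdeg, le_div_iff₀ (by positivity)]
    refine le_trans ?_ hcard
    rw [mul_div_assoc, ← hθ]
    push_cast
    linarith
  exact (ProbabilityMeasure.tendsto_nhds_iff_toFiniteMeasure_tendsto_nhds _).1 key

end ZeroMeasure

/-! ### Constant and linear starting polynomials, and the main theorem -/

section Main

open Real

/-- Inverting `tanhOp_iterate_linear` makes the Rolle argument for starting degree at most one
available. -/
lemma iterComb_eq_iterate {m : ℕ} (a b : ℝ) (n : ℕ) :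
    iterComb m a b n = (tanhOp m)^[n] (C (a * ((m + 1) * (m + 2))) * X -
      C (a * (3 * m + 2) - b)) := by
  have h : ((m + 1) * (m + 2) : ℝ) ≠ 0 := by positivity
  rw [tanhOp_iterate_linear, iterComb, mul_div_cancel_right₀ _ h,
    show a * ((m + 1) * (m + 2)) * (3 * m + 2) / ((m + 1) * (m + 2)) - (a * (3 * m + 2) - b) = b by
      field_simp; ring]

lemma splits_and_natDegree_iterComb {m : ℕ} (hm : m ≠ 0) {a : ℝ} (ha : a ≠ 0) (b : ℝ) (n : ℕ) :
    (iterComb m a b n).Splits ∧ (iterComb m a b n).natDegree = n + 1 := by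
  have h : a * ((m + 1) * (m + 2) : ℝ) ≠ 0 := mul_ne_zero ha (by positivity)
  have hd : (C (a * ((m + 1) * (m + 2) : ℝ)) * X - C (a * (3 * m + 2) - b)).natDegree = 1 := by
    rw [natDegree_sub_C, natDegree_C_mul_X _ h]
  have h0 : C (a * ((m + 1) * (m + 2) : ℝ)) * X - C (a * (3 * m + 2) - b) ≠ 0 := fun h0 => by
    rw [h0, natDegree_zero] at hd
    omega
  rw [iterComb_eq_iterate]
  exact ⟨splits_tanhOp_iterate hm h0 hd.le n, by rw [(tanhOp_iterate_ne_zero m n h0).2, hd]; ring⟩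

lemma iterSeq_linear_eq_iterComb (m : ℕ) {w : ℕ → ℝ} (hw : ∀ n, 1 ≤ n → w n ≠ 0) {c : ℝ}
    (hc : c ≠ 0) (d : ℝ) :
    ∃ a b : ℝ, a ≠ 0 ∧ ∀ n, ∃ K : ℝ, K ≠ 0 ∧
      iterSeq (tanhOp m) w (C c * X - C d) (n + 1) = C K * iterComb m a b n := by
  refine ⟨c / ((m + 1) * (m + 2)), c * (3 * m + 2) / ((m + 1) * (m + 2)) - d,
    div_ne_zero hc (by positivity), fun n => ?_⟩
  obtain ⟨K, hK, h⟩ := iterSeq_tanhOp m w hw (C c * X - C d) n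
  exact ⟨K, hK, by rw [h, tanhOp_iterate_linear]; rfl⟩

/-- The index starts at `2` because `iterComb m 1 0 n` is the iterate of order `n + 1`. -/
lemma iterSeq_const_eq_iterComb (m : ℕ) {w : ℕ → ℝ} (hw : ∀ n, 1 ≤ n → w n ≠ 0) {c : ℝ}
    (hc : c ≠ 0) (n : ℕ) : ∃ K : ℝ, K ≠ 0 ∧
      iterSeq (tanhOp m) w (C c) (n + 1 + 1) = C K * iterComb m 1 0 n := by
  obtain ⟨K, hK, h⟩ := iterSeq_tanhOp m w hw (C c) (n + 1)
  refine ⟨K * c, mul_ne_zero hK hc, ?_⟩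
  have h1 := tanhOp_iterate_C_mul_add m (n + 1) c 0 1 0
  rw [h, iterComb]
  simp only [mul_one, C_0, mul_zero, zero_mul, add_zero, C_1, one_mul, C_mul] at h1 ⊢
  rw [h1, mul_assoc]

lemma splits_and_natDegree_of_eq_iterComb {m : ℕ} (hm : m ≠ 0) {a : ℝ} (ha : a ≠ 0) {b : ℝ}
    {n : ℕ} {p : ℝ[X]} (hp : ∃ K : ℝ, K ≠ 0 ∧ p = C K * iterComb m a b n) :
    p.Splits ∧ p.natDegree = n + 1 := by
  obtain ⟨K, hK, rfl⟩ := hp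
  obtain ⟨h1, h2⟩ := splits_and_natDegree_iterComb hm ha b n
  exact ⟨(Splits.C K).mul h1, by rw [natDegree_C_mul hK, h2]⟩

lemma tendsto_zeroMeasure_of_eq_iterComb {m : ℕ} (hm : m ≠ 0)
    (h0 : ∀ u : ℝ, 0 < u →
      (latticeSum (m + 1) u).im = -(1 / 2) * (sinh u / cosh u ^ (m + 1)))
    {a : ℝ} (ha : a ≠ 0) {b : ℝ} {p : ℕ → ℝ[X]}
    (hp : ∀ n, ∃ K : ℝ, K ≠ 0 ∧ p n = C K * iterComb m a b n) :
    Tendsto (fun n => zeroMeasure (p n)) atTop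
      (𝓝 (ProbabilityMeasure.toFiniteMeasure ⟨limitMeasure, inferInstance⟩)) := by
  have h := tendsto_zeroMeasure_of_many_roots
    (fun n => (splits_and_natDegree_iterComb hm ha b n).1)
    (fun n => (splits_and_natDegree_iterComb hm ha b n).2)
    (fun α β => eventually_exists_finset_roots_iterComb hm h0 ha b)
  refine h.congr fun n => ?_
  obtain ⟨K, hK, hpn⟩ := hp n
  rw [hpn, zeroMeasure_C_mul hK]

lemma coeffXi_ne_zero (n : ℕ) (hn : 1 ≤ n) : coeffXi n ≠ 0 := by
  have : (0 : ℝ) < n := by exact_mod_cast hn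
  exact div_ne_zero (by norm_num) (by positivity)

lemma coeffLambda_ne_zero (n : ℕ) (_ : 1 ≤ n) : coeffLambda n ≠ 0 := by
  have h : ∀ k : ℕ, k ≠ 0 → (0 : ℝ) < 2 ^ k - 1 := fun k hk =>
    sub_pos.2 (one_lt_pow₀ one_lt_two hk)
  have h1 := h (2 * n + 1) (by omega)
  have h2 := h (2 * n + 3) (by omega)
  exact div_ne_zero (neg_ne_zero.2 h1.ne') (by positivity)

end Main

theorem mainTheorem2 (c d : ℝ) (hc : c ≠ 0) (A B : ℕ → ℝ)
    (hA : ∀ n : ℕ, 1 ≤ n → A n ≠ 0) (hB : ∀ n : ℕ, 1 ≤ n → B n ≠ 0) :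
    -- all polynomials are real-rooted, of the expected degrees
    (∀ n : ℕ, 1 ≤ n →
      ((auxXi n).Splits ∧ (auxXi n).natDegree = n - 1) ∧
      ((auxLambda n).Splits ∧ (auxLambda n).natDegree = n - 1) ∧
      ((seqXi A c d n).Splits ∧ (seqXi A c d n).natDegree = n) ∧
      ((seqLambda B c d n).Splits ∧ (seqLambda B c d n).natDegree = n)) ∧
    -- one limit for all four families of empirical zero measures
    ∃ μ : ProbabilityMeasure ℝ,
      (μ : Measure ℝ) = limitMeasure ∧ μ (Set.Ioo 0 1) = 1 ∧
      Tendsto (fun n => zeroMeasure (auxXi n)) atTop (𝓝 μ.toFiniteMeasure) ∧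
      Tendsto (fun n => zeroMeasure (auxLambda n)) atTop (𝓝 μ.toFiniteMeasure) ∧
      Tendsto (fun n => zeroMeasure (seqXi A c d n)) atTop (𝓝 μ.toFiniteMeasure) ∧
      Tendsto (fun n => zeroMeasure (seqLambda B c d n)) atTop (𝓝 μ.toFiniteMeasure) := by
  have hX : ∀ n, ∃ K : ℝ, K ≠ 0 ∧ auxXi (n + 1 + 1) = C K * iterComb 1 1 0 n := by
    rw [auxXi, opXi_eq_tanhOp]
    exact iterSeq_const_eq_iterComb 1 coeffXi_ne_zero (by norm_num)
  have hL : ∀ n, ∃ K : ℝ, K ≠ 0 ∧ auxLambda (n + 1 + 1) = C K * iterComb 2 1 0 n := by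
    rw [auxLambda, opLambda_eq_tanhOp]
    exact iterSeq_const_eq_iterComb 2 coeffLambda_ne_zero (by norm_num)
  obtain ⟨a, b, ha, hP⟩ := iterSeq_linear_eq_iterComb 1 hA hc d
  obtain ⟨a', b', ha', hQ⟩ := iterSeq_linear_eq_iterComb 2 hB hc d
  rw [← opXi_eq_tanhOp] at hP
  rw [← opLambda_eq_tanhOp] at hQ
  have h2 := fun (u : ℝ) (hu : 0 < u) => im_latticeSum_two hu
  have h3 := fun (u : ℝ) (hu : 0 < u) => im_latticeSum_three hu
  refine ⟨fun n hn => ?_, ⟨limitMeasure, inferInstance⟩, rfl, ?_, ?_, ?_, ?_, ?_⟩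
  · obtain ⟨n, rfl⟩ : ∃ k, n = k + 1 := ⟨n - 1, by omega⟩
    refine ⟨?_, ?_, splits_and_natDegree_of_eq_iterComb one_ne_zero ha (hP n),
      splits_and_natDegree_of_eq_iterComb two_ne_zero ha' (hQ n)⟩
    · rcases n with _ | n
      · exact ⟨Splits.C _, natDegree_C _⟩
      · exact splits_and_natDegree_of_eq_iterComb one_ne_zero one_ne_zero (hX n)
    · rcases n with _ | n
      · exact ⟨Splits.C _, natDegree_C _⟩
      · exact splits_and_natDegree_of_eq_iterComb two_ne_zero one_ne_zero (hL n)
  · change (limitMeasure (Set.Ioo 0 1)).toNNReal = 1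
    rw [limitMeasure_Ioo, ENNReal.toNNReal_one]
  -- The shift discards the unused index `0` and the constant polynomial at index `1`.
  · exact (tendsto_add_atTop_iff_nat 2).1
      (tendsto_zeroMeasure_of_eq_iterComb one_ne_zero h2 one_ne_zero hX)
  · exact (tendsto_add_atTop_iff_nat 2).1
      (tendsto_zeroMeasure_of_eq_iterComb two_ne_zero h3 one_ne_zero hL)
  · exact (tendsto_add_atTop_iff_nat 1).1
      (tendsto_zeroMeasure_of_eq_iterComb one_ne_zero h2 ha hP)
  · exact (tendsto_add_atTop_iff_nat 1).1
      (tendsto_zeroMeasure_of_eq_iterComb two_ne_zero h3 ha' hQ)
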